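/- Let $G$ be a (finite-dimensional, real) Lie group with Lie algebra $\mathfrak g$, let $H\subset G$ be any subgroup that is dense in $G$ (not assumed closed), and let $\mathfrak h=\{Z\in\mathfrak g: e^{tZ}\in H \text{ for all } t\in\mathbb R\}$. For $p\in T^*_qG$ write $gp\in T^*_{gq}G$ and $pg\in T^*_{qg}G$ for its left and right translates, $\langle gp,v\rangle=\langle p,g^{-1}v\rangle$ and $\langle pg,v\rangle=\langle p,vg^{-1}\rangle$. A *parasymplectic Hamiltonian $G$-space* is a triple $(X,\omega,\Phi)$ of a diffeological space $X$ with a smooth $G$-action, a closed $G$-invariant (diffeological) $2$-form $\omega$ on $X$, and a smooth $\mathrm{Ad}^*$-equivariant map $\Phi:X\to\mathfrak g^*$ with $\omega(Z_X,\cdot)=-d\langle\Phi(\cdot),Z\rangle$ for all $Z\in\mathfrak g$, where $Z_X$ is the infinitesimal action of $Z$. An isomorphism of such spaces is a $G$-equivariant diffeological diffeomorphism that pulls back one $2$-form to the other and intertwines the moment maps. *The induced space.* Let $\varpi(\delta p)=\langle p,\delta q\rangle$ be the canonical $1$-form of $T^*G$, and let $\psi:T^*G\to\mathfrak h^*$,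 $\psi(p)=-(q^{-1}p)|_{\mathfrak h}$ ($p\in T_q^*G$), be the moment map of the action $h(p)=ph^{-1}$ of $H$. Put $$\mathrm{Ind}_H^G\{0\}=(T^*G)/\!\!/H:=\psi^{-1}(0)/H$$ with the quotient of the subset diffeology of $\psi^{-1}(0)\subset T^*G$, the residual action $g(pH)=(gp)H$ of $G$ and the residual map $pH\mapsto pq^{-1}\in\mathfrak g^*$. A reduced $2$-form is a $2$-form $\omega_{\mathrm{red}}$ on $(T^*G)/\!\!/H$ whose pull-back to $\psi^{-1}(0)$ equals the restriction of $d\varpi$. *The cotangent space.* For a diffeological space $X$, let $\Omega^1(X)$ be its space of $1$-forms with the functional diffeology, and let $T^*(X)$ be the quotient of $X\times\Omega^1(X)$ by the relation $(x,\alpha)\sim(x,\beta)$ whenever $\alpha-\beta$ vanishes at $x$, i.e. $P^*\alpha$ and $P^*\beta$ agree at $0$ for every plot $P$ with $P(0)=x$. The Liouville form $\mathrm{Liouv}\in\Omega^1(T^*(X))$ is the $1$-form whose pull-back to $X\times\Omega^1(X)$ is given on plots $P\times A$ by $\delta u\mapsto P^*(A(u))(\delta u)$. If $G$ acts smoothly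 on $X$, it acts on $T^*(X)$ by $g(x,\alpha)=(g(x),g_*\alpha)$, with moment map $\Phi(y)=$ value at $e$ of $\hat y^*\mathrm{Liouv}\in\Omega^1(G)$, where $\hat y(g)=g(y)$. This applies to $X=G/H$ with its quotient diffeology and the action of $G$ by left translations. **Theorem.** If $H$ is dense in $G$, then $(T^*G)/\!\!/H$ carries exactly one reduced $2$-form $\omega_{\mathrm{red}}$; with $\omega_{\mathrm{red}}$, the residual action and the residual moment map it is a parasymplectic Hamiltonian $G$-space; $T^*(G/H)$ with $d\,\mathrm{Liouv}$, the above action and the moment map $\Phi$ is a parasymplectic Hamiltonian $G$-space; and these two parasymplectic Hamiltonian $G$-spaces are isomorphic. -/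

import Mathlib

open scoped Manifold ContDiff Topology
open Diffeology

noncomputable section

namespace DiffeoKMS

/-- The test spaces `ℝⁿ` on which plots are defined. -/
abbrev Euc (n : ℕ) := EuclideanSpace ℝ (Fin n)

/-- Smooth maps from a vector space `V` to a manifold `M`. -/
abbrev SmoothMap {V : Type*} [NormedAddCommGroup V] [NormedSpace ℝ V] {E H : Type*}
    [NormedAddCommGroup E] [NormedSpace ℝ E] [TopologicalSpace H] (I : ModelWithCorners ℝ E H)
    {M : Type*} [TopologicalSpace M] [ChartedSpace H M] (p : V → M) : Prop :=
  ContMDiff 𝓘(ℝ, V) I ∞ p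

/-- The derivative at `u` of a map from a vector space `V` to a manifold `M` modelled on `E`. -/
abbrev derivAt {V : Type*} [NormedAddCommGroup V] [NormedSpace ℝ V] {E : Type*}
    [NormedAddCommGroup E] [NormedSpace ℝ E] {M : Type*} [TopologicalSpace M] [ChartedSpace E M]
    (p : V → M) (u : V) : V →L[ℝ] TangentSpace 𝓘(ℝ, E) (p u) :=
  mfderiv 𝓘(ℝ, V) 𝓘(ℝ, E) p u

/-! ### Localisation of plots -/

/-- A smooth self-map with values in a given neighbourhood of `x`, equal to the identity near `x`. -/
theorem exists_confine {V : Type*} [NormedAddCommGroup V] [NormedSpace ℝ V] [FiniteDimensional ℝ V]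
    {u : Set V} {x : V} (hu : u ∈ 𝓝 x) :
    ∃ f : V → V, ContDiff ℝ ∞ f ∧ (∀ y, f y ∈ u) ∧ f =ᶠ[𝓝 x] id := by
  obtain ⟨ε, hε, hb⟩ := Metric.mem_nhds_iff.1 hu
  let χ : ContDiffBump x := ⟨ε / 4, ε / 2, by positivity, by linarith⟩
  refine ⟨fun y => x + χ y • (y - x), ?_, ?_, ?_⟩
  · exact contDiff_const.add (χ.contDiff.smul (contDiff_id.sub contDiff_const))
  · intro y
    apply hb
    rw [Metric.mem_ball, dist_eq_norm, add_sub_cancel_left, norm_smul]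
    by_cases hy : y ∈ Metric.ball x (ε / 2)
    · have h1 : ‖χ y‖ ≤ 1 := by
        rw [Real.norm_eq_abs, abs_of_nonneg χ.nonneg]; exact χ.le_one
      have h2 : ‖y - x‖ < ε / 2 := by rwa [Metric.mem_ball, dist_eq_norm] at hy
      nlinarith [norm_nonneg (y - x), norm_nonneg (χ y)]
    · have : χ y = 0 := χ.zero_of_le_dist (by simpa using hy)
      simpa [this] using hε
  · filter_upwards [χ.eventuallyEq_one] with y hy
    simp [hy]

/-! ### Subset, product and quotient diffeologies; the diffeology of a manifold -/

/-- The subset diffeology. -/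
instance subtypeDiffeology {X : Type*} [DiffeologicalSpace X] {P : X → Prop} :
    DiffeologicalSpace {x // P x} where
  plots n := {p | IsPlot (fun y => (p y : X))}
  constant_plots _ := isPlot_const
  plot_reparam hp hf := isPlot_reparam hp hf
  locality h := DiffeologicalSpace.locality fun x => by
    obtain ⟨u, hu, hx, hf⟩ := h x
    exact ⟨u, hu, hx, fun h1 h2 => hf h1 h2⟩

/-- The product diffeology. -/
instance prodDiffeology {X Y : Type*} [DiffeologicalSpace X] [DiffeologicalSpace Y] :
    DiffeologicalSpace (X × Y) where
  plots n := {p | IsPlot (fun y => (p y).1) ∧ IsPlot (fun y => (p y).2)}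
  constant_plots _ := ⟨isPlot_const, isPlot_const⟩
  plot_reparam hp hf := ⟨isPlot_reparam hp.1 hf, isPlot_reparam hp.2 hf⟩
  locality h := by
    constructor
    · refine DiffeologicalSpace.locality fun x => ?_
      obtain ⟨u, hu, hx, hf⟩ := h x
      exact ⟨u, hu, hx, fun h1 h2 => (hf h1 h2).1⟩
    · refine DiffeologicalSpace.locality fun x => ?_
      obtain ⟨u, hu, hx, hf⟩ := h x
      exact ⟨u, hu, hx, fun h1 h2 => (hf h1 h2).2⟩

/-- The quotient diffeology: the plots are the maps that lift locally to plots upstairs. -/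
instance quotientDiffeology {X : Type*} [DiffeologicalSpace X] {s : Setoid X} :
    DiffeologicalSpace (Quotient s) where
  plots n := {p | ∀ x, ∃ q : Euc n → X, IsPlot q ∧ (fun y => Quotient.mk s (q y)) =ᶠ[𝓝 x] p}
  constant_plots c := fun x => by
    obtain ⟨a, rfl⟩ := Quotient.exists_rep c
    exact ⟨fun _ => a, isPlot_const, Filter.EventuallyEq.rfl⟩
  plot_reparam {n m p f} hp hf := fun x => by
    obtain ⟨q, hq, hqp⟩ := hp (f x)
    exact ⟨q ∘ f, isPlot_reparam hq hf, hf.continuous.continuousAt.eventually hqp⟩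
  locality {n p} h := fun x => by
    obtain ⟨u, hu, hx, hf⟩ := h x
    obtain ⟨f, f1, f2, f3⟩ := exists_confine (hu.mem_nhds hx)
    obtain ⟨q, hq, hqp⟩ := hf f2 f1 x
    refine ⟨q, hq, hqp.trans ?_⟩
    filter_upwards [f3] with y hy
    simp [hy]

/-- The quotient diffeology on a coset space `G ⧸ H`. -/
instance cosetDiffeology {G : Type*} [Group G] [DiffeologicalSpace G] (H : Subgroup G) :
    DiffeologicalSpace (G ⧸ H) :=
  inferInstanceAs (DiffeologicalSpace (Quotient (QuotientGroup.leftRel H)))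

/-- The standard diffeology of a manifold: the plots are the smooth maps `ℝⁿ → M`. -/
abbrev manifoldDiffeology {E H : Type*} [NormedAddCommGroup E] [NormedSpace ℝ E]
    [TopologicalSpace H] (I : ModelWithCorners ℝ E H) (M : Type*) [TopologicalSpace M]
    [ChartedSpace H M] : DiffeologicalSpace M where
  plots n := {p | SmoothMap I p}
  constant_plots _ := contMDiff_const
  plot_reparam hp hf := hp.comp hf.contMDiff
  locality {n p} h := fun x => by
    obtain ⟨u, hu, hx, hf⟩ := h x
    obtain ⟨f, f1, f2, f3⟩ := exists_confine (hu.mem_nhds hx)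
    refine ((hf f2 f1) x).congr_of_eventuallyEq ?_
    filter_upwards [f3] with y hy
    simp [hy]

/-- The diffeology on the manifold `M` (modelled on `E`) is its standard manifold diffeology. -/
class IsManifoldDiffeology (E : Type*) [NormedAddCommGroup E] [NormedSpace ℝ E]
    (M : Type*) [TopologicalSpace M] [ChartedSpace E M] [DiffeologicalSpace M] : Prop where
  isPlot_iff {n : ℕ} {p : Euc n → M} : IsPlot p ↔ SmoothMap 𝓘(ℝ, E) p

/-- Every manifold has exactly one diffeology of this kind. -/
theorem isManifoldDiffeology_iff (E : Type*) [NormedAddCommGroup E] [NormedSpace ℝ E]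
    (M : Type*) [TopologicalSpace M] [ChartedSpace E M] [d : DiffeologicalSpace M] :
    IsManifoldDiffeology E M ↔ d = manifoldDiffeology 𝓘(ℝ, E) M :=
  ⟨fun h => DiffeologicalSpace.ext (by ext n p; exact h.isPlot_iff), fun h => by
    subst h; exact @IsManifoldDiffeology.mk _ _ _ _ _ _ (_) Iff.rfl⟩

theorem dSmooth_mk {X : Type*} [DiffeologicalSpace X] (s : Setoid X) :
    DSmooth (Quotient.mk s) :=
  fun _ p hp _ => ⟨p, hp, Filter.EventuallyEq.rfl⟩

theorem dSmooth_val {X : Type*} [DiffeologicalSpace X] (P : X → Prop) :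
    DSmooth (Subtype.val : {x // P x} → X) := fun _ _ hp => hp

/-! ### Differential forms on diffeological spaces -/

/-- A differential `k`-form on a diffeological space `X`: a smooth `k`-form `α(p)` on `ℝⁿ` for every
plot `p : ℝⁿ → X`, such that `α(p ∘ f) = f^* α(p)` for every smooth `f : ℝᵐ → ℝⁿ`. -/
@[ext]
structure DForm (X : Type*) [DiffeologicalSpace X] (k : ℕ) where
  toFun : ∀ {n : ℕ} (p : Euc n → X), IsPlot p → Euc n → (Euc n) [⋀^Fin k]→L[ℝ] ℝ
  smooth : ∀ {n : ℕ} (p : Euc n → X) (hp : IsPlot p), ContDiff ℝ ∞ (toFun p hp)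
  compat : ∀ {m n : ℕ} (p : Euc n → X) (hp : IsPlot p) (f : Euc m → Euc n) (hf : ContDiff ℝ ∞ f)
    (y : Euc m), toFun (p ∘ f) (isPlot_reparam hp hf) y =
      (toFun p hp (f y)).compContinuousLinearMap (fderiv ℝ f y)

namespace DForm

variable {X Y : Type*} [DiffeologicalSpace X] [DiffeologicalSpace Y] {k : ℕ}

theorem toFun_congr (α : DForm X k) {n : ℕ} {p q : Euc n → X} (h : p = q) (hp : IsPlot p)
    (hq : IsPlot q) : α.toFun p hp = α.toFun q hq := by
  subst h; rfl

/-- The pull-back `f^* α`, given by `(f^* α)(p) = α(f ∘ p)`. -/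
def pullback (f : X → Y) (hf : DSmooth f) (α : DForm Y k) : DForm X k where
  toFun p hp := α.toFun (f ∘ p) (hf _ p hp)
  smooth _ _ := α.smooth _ _
  compat p hp g hg y := α.compat (f ∘ p) (hf _ p hp) g hg y

/-- The exterior derivative, given by `(dα)(p) = d(α(p))`. -/
def d (α : DForm X k) : DForm X (k + 1) where
  toFun p hp := extDeriv (α.toFun p hp)
  smooth p hp := by
    have h := (α.smooth p hp).fderiv_right (m := ∞) (by simp)
    exact (ContinuousAlternatingMap.alternatizeUncurryFinCLM ℝ _ ℝ).contDiff.comp h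
  compat p hp f hf y := by
    have h : α.toFun (p ∘ f) (isPlot_reparam hp hf) =
        fun y => (α.toFun p hp (f y)).compContinuousLinearMap (fderiv ℝ f y) :=
      funext fun y => α.compat p hp f hf y
    rw [h]
    exact extDeriv_pullback (r := ∞) ((α.smooth p hp).differentiable (by simp) _) hf.contDiffAt
      (by simp only [minSmoothness_of_isRCLikeNormedField]; exact WithTop.coe_le_coe.2 (le_top (a := (2 : ℕ∞))))

/-- The value of a form on a plot at a point depends only on the germ of the plot. -/
theorem toFun_eq_of_comp (α : DForm X k) {n : ℕ} {p q : Euc n → X} (hp : IsPlot p) (hq : IsPlot q)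
    {f : Euc n → Euc n} (hf : ContDiff ℝ ∞ f) {u : Euc n} (hfu : f =ᶠ[𝓝 u] id)
    (h : α.toFun (p ∘ f) (isPlot_reparam hp hf) u = α.toFun (q ∘ f) (isPlot_reparam hq hf) u) :
    α.toFun p hp u = α.toFun q hq u := by
  rw [α.compat p hp f hf, α.compat q hq f hf, hfu.fderiv_eq, hfu.self_of_nhds] at h
  simp only [id_eq, fderiv_id] at h
  exact h

theorem toFun_germ (α : DForm X k) {n : ℕ} {p q : Euc n → X} (hp : IsPlot p) (hq : IsPlot q)
    {u : Euc n} (h : p =ᶠ[𝓝 u] q) : α.toFun p hp u = α.toFun q hq u := by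
  obtain ⟨f, f1, f2, f3⟩ := exists_confine h
  refine α.toFun_eq_of_comp hp hq f1 f3 (congrFun (α.toFun_congr (funext fun y => f2 y) _ _) u)

/-- Two plots with the same germ of projection to the quotient give the same value of `α`, if plots
with the same projection do. -/
theorem descend_aux {s : Setoid X} (α : DForm X k)
    (h : ∀ (n : ℕ) (p q : Euc n → X) (hp : IsPlot p) (hq : IsPlot q),
      (∀ u, Quotient.mk s (p u) = Quotient.mk s (q u)) → α.toFun p hp = α.toFun q hq)
    {n : ℕ} {p q : Euc n → X} (hp : IsPlot p) (hq : IsPlot q)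
    {u : Euc n} (he : (fun y => Quotient.mk s (p y)) =ᶠ[𝓝 u] fun y => Quotient.mk s (q y)) :
    α.toFun p hp u = α.toFun q hq u := by
  obtain ⟨f, f1, f2, f3⟩ := exists_confine he
  exact α.toFun_eq_of_comp hp hq f1 f3 (congrFun (h _ _ _ _ _ fun y => f2 y) u)

/-- The form on the quotient whose pull-back is `α`, when `α` takes the same value on any two
plots with the same projection. -/
def descend {s : Setoid X} (α : DForm X k)
    (h : ∀ (n : ℕ) (p q : Euc n → X) (hp : IsPlot p) (hq : IsPlot q),
      (∀ u, Quotient.mk s (p u) = Quotient.mk s (q u)) → α.toFun p hp = α.toFun q hq) :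
    DForm (Quotient s) k where
  toFun p hp u := α.toFun (hp u).choose (hp u).choose_spec.1 u
  smooth {n} p hp := by
    rw [contDiff_iff_contDiffAt]
    intro u
    refine ((α.smooth _ (hp u).choose_spec.1).contDiffAt (x := u)).congr_of_eventuallyEq ?_
    filter_upwards [(hp u).choose_spec.2.eventually_nhds] with w hw
    exact α.descend_aux h _ _ ((hp w).choose_spec.2.trans (Filter.EventuallyEq.symm hw))
  compat {m n} p hp f hf y := by
    rw [← α.compat _ _ f hf y]
    refine α.descend_aux h _ _ ((isPlot_reparam hp hf y).choose_spec.2.trans ?_)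
    exact (hf.continuous.continuousAt.eventually (hp (f y)).choose_spec.2).mono
      fun _ hw => hw.symm

theorem pullback_descend {s : Setoid X} (α : DForm X k)
    (h : ∀ (n : ℕ) (p q : Euc n → X) (hp : IsPlot p) (hq : IsPlot q),
      (∀ u, Quotient.mk s (p u) = Quotient.mk s (q u)) → α.toFun p hp = α.toFun q hq) :
    (α.descend h).pullback (Quotient.mk s) (dSmooth_mk s) = α := by
  ext1
  funext n p hp u
  exact α.descend_aux h _ _ ((dSmooth_mk s _ p hp) u).choose_spec.2

/-- The functional diffeology on the space of `k`-forms: a map `A` to it is a plot if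
`(u, v) ↦ A(u)(p)(v)` is smooth for every plot `p` of `X`. -/
instance functionalDiffeology : DiffeologicalSpace (DForm X k) where
  plots n := {A | ∀ (m : ℕ) (p : Euc m → X) (hp : IsPlot p),
    ContDiff ℝ ∞ (fun w : Euc n × Euc m => (A w.1).toFun p hp w.2)}
  constant_plots α := fun m p hp => (α.smooth p hp).comp contDiff_snd
  plot_reparam {n m A f} hA hf := fun l p hp =>
    (hA l p hp).comp ((hf.comp contDiff_fst).prodMk contDiff_snd)
  locality {n A} h := fun m p hp => by
    rw [contDiff_iff_contDiffAt]
    rintro ⟨x, y⟩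
    obtain ⟨u, hu, hx, hf⟩ := h x
    obtain ⟨f, f1, f2, f3⟩ := exists_confine (hu.mem_nhds hx)
    refine (((hf f2 f1) m p hp).contDiffAt (x := (x, y))).congr_of_eventuallyEq ?_
    filter_upwards [continuous_fst.continuousAt.eventually f3] with w hw
    simp only [Function.comp_apply]
    rw [hw]; rfl

end DForm

/-! ### The cotangent space of a diffeological space and its Liouville form -/

section Cotangent

variable (X : Type*) [DiffeologicalSpace X]

/-- `(x, α)` and `(y, β)` define the same covector if `x = y` and `α`, `β` have the same value at
`x`: they agree at `0` on every plot centred at `x`, i.e. `α - β` vanishes at `x`. -/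
def cotSetoid : Setoid (X × DForm X 1) where
  r a b := a.1 = b.1 ∧ ∀ (n : ℕ) (p : Euc n → X) (hp : IsPlot p), p 0 = a.1 →
    a.2.toFun p hp 0 = b.2.toFun p hp 0
  iseqv :=
    { refl := fun _ => ⟨rfl, fun _ _ _ _ => rfl⟩
      symm := fun h => ⟨h.1.symm, fun n p hp h0 => (h.2 n p hp (h0.trans h.1.symm)).symm⟩
      trans := fun h h' => ⟨h.1.trans h'.1, fun n p hp h0 =>
        (h.2 n p hp h0).trans (h'.2 n p hp (h0.trans h.1))⟩ }

/-- The cotangent space `T^*(X)`: pairs of a point `x` and a `1`-form modulo the `1`-forms vanishing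
at `x`, with the quotient of the product of the diffeology of `X` and the functional diffeology. -/
def DCotangent : Type _ := Quotient (cotSetoid X)

instance : DiffeologicalSpace (DCotangent X) :=
  inferInstanceAs (DiffeologicalSpace (Quotient (cotSetoid X)))

/-- The tautological `1`-form on `X × Ω¹(X)`, given by `Taut(P × A)(δu) = P^*(A(u))(δu)`. -/
def taut : DForm (X × DForm X 1) 1 where
  toFun p hp u := (p u).2.toFun (fun w => (p w).1) hp.1 u
  smooth _ hp := (hp.2 _ _ hp.1).comp (contDiff_id.prodMk contDiff_id)
  compat p hp f hf y := (p (f y)).2.compat (fun w => (p w).1) hp.1 f hf y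

variable {X} in
/-- Forms with the same value at `p u` agree at `u` on the plot `p`. -/
theorem toFun_eq_of_sameValue {α β : DForm X 1} {x : X} (h : cotSetoid X (x, α) (x, β))
    {n : ℕ} (p : Euc n → X) (hp : IsPlot p) (u : Euc n) (hu : p u = x) :
    α.toFun p hp u = β.toFun p hp u := by
  have ht : ContDiff ℝ ∞ (fun w : Euc n => w + u) := contDiff_id.add contDiff_const
  have h0 := h.2 n (p ∘ fun w => w + u) (isPlot_reparam hp ht) (by simpa using hu)
  have hd : fderiv ℝ (fun w : Euc n => w + u) 0 = ContinuousLinearMap.id ℝ _ := by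
    rw [fderiv_add_const]; exact fderiv_id
  rw [α.compat p hp _ ht, β.compat p hp _ ht, hd] at h0
  simp only [zero_add] at h0
  exact h0

/-- The Liouville `1`-form on `T^*(X)`: the form whose pull-back to `X × Ω¹(X)` is the tautological
form. -/
def liouville : DForm (DCotangent X) 1 :=
  (taut X).descend (s := cotSetoid X) fun n p q hp hq h => by
    have h' : ∀ u, cotSetoid X (p u) (q u) := fun u => Quotient.exact (h u)
    have h1 : (fun w => (p w).1) = fun w => (q w).1 := funext fun w => (h' w).1
    funext u
    have e := (q u).2.toFun_congr h1 hp.1 hq.1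
    refine Eq.trans (toFun_eq_of_sameValue (x := (p u).1) ?_ _ hp.1 u rfl) (congrFun e u)
    exact ⟨rfl, (h' u).2⟩

theorem pullback_liouville :
    (liouville X).pullback (Quotient.mk (cotSetoid X)) (dSmooth_mk _) = taut X :=
  DForm.pullback_descend (taut X) _

end Cotangent

/-! ### Actions -/

section Action

variable (G : Type*) [Group G] [DiffeologicalSpace G]

/-- The action map `G × X → X` is smooth. -/
class IsSmoothAction (X : Type*) [DiffeologicalSpace X] [MulAction G X] : Prop where
  dSmooth_smul : DSmooth fun a : G × X => a.1 • a.2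

variable {G} {X : Type*} [DiffeologicalSpace X] [MulAction G X]

theorem dSmooth_smul_left [IsSmoothAction G X] (g : G) : DSmooth fun x : X => g • x :=
  fun n p hp => IsSmoothAction.dSmooth_smul (G := G) (X := X) n (fun y => (g, p y))
    ⟨isPlot_const, hp⟩

variable [IsSmoothAction G X]

/-- The push-forward `g_* α = (g⁻¹)^* α` of a form by the action of `g`. -/
def DForm.push {k : ℕ} (g : G) (α : DForm X k) : DForm X k :=
  α.pullback (fun x => g⁻¹ • x) (dSmooth_smul_left g⁻¹)

/-- The action `g(x, α) = (g(x), g_* α)` on `T^*(X)`. -/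
instance : MulAction G (DCotangent X) where
  smul g := Quotient.map (fun a => (g • a.1, a.2.push g)) fun a b h =>
    ⟨congrArg (g • ·) h.1, fun n p hp h0 =>
      h.2 n _ (dSmooth_smul_left g⁻¹ n p hp) (by simp [h0])⟩
  one_smul y := by
    induction y using Quotient.inductionOn with
    | h a =>
      refine Quotient.sound ⟨one_smul G a.1, fun n p hp _ => ?_⟩
      exact congrFun (a.2.toFun_congr (funext fun y => by simp) _ _) 0
  mul_smul g h y := by
    induction y using Quotient.inductionOn with
    | h a =>
      refine Quotient.sound ⟨mul_smul g h a.1, fun n p hp _ => ?_⟩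
      exact congrFun (a.2.toFun_congr (funext fun y => by simp [mul_smul]) _ _) 0

end Action

/-! ### Cotangent bundles of manifolds -/

section Manifold

variable {E : Type*} [NormedAddCommGroup E] [NormedSpace ℝ E]
  {M : Type*} [TopologicalSpace M] [ChartedSpace E M] [IsManifold 𝓘(ℝ, E) ∞ M]

variable (E M) in
/-- The cotangent bundle `T^*M` of a manifold `M` modelled on `E`. -/
abbrev CotangentBundle :=
  Bundle.TotalSpace (E →L[ℝ] ℝ)
    (fun x : M => TangentSpace 𝓘(ℝ, E) x →L[ℝ] Bundle.Trivial M ℝ x)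

instance : DiffeologicalSpace (CotangentBundle E M) :=
  manifoldDiffeology (𝓘(ℝ, E).prod 𝓘(ℝ, E →L[ℝ] ℝ)) (CotangentBundle E M)

/-- The covector `δu ↦ ⟨p, δq⟩` on `ℝⁿ`, for `p = P(u)` depending on `u ∈ ℝⁿ`, with base point
`q = q(u)`; here `δq` is the image of `δu` under the derivative of `u ↦ q(u)`. -/
def pullCovector {n : ℕ} (P : Euc n → CotangentBundle E M) (u : Euc n) : Euc n →L[ℝ] ℝ :=
  (P u).2.comp (derivAt (fun w => (P w).1) u)

theorem contMDiff_base {n : ℕ} {P : Euc n → CotangentBundle E M} (hP : IsPlot P) :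
    SmoothMap 𝓘(ℝ, E) (fun w => (P w).1) :=
  (Bundle.contMDiff_proj _).comp hP

theorem contDiff_pullCovector {n : ℕ} {P : Euc n → CotangentBundle E M} (hP : IsPlot P) :
    ContDiff ℝ ∞ (pullCovector P) := by
  rw [contDiff_clm_apply_iff]
  intro v
  have hq := contMDiff_base hP
  have h1 : ContMDiff 𝓘(ℝ, Euc n) 𝓘(ℝ, Euc n).tangent ∞
      (fun w : Euc n => (⟨w, v⟩ : TangentBundle 𝓘(ℝ, Euc n) (Euc n))) := by
    intro w
    refine Bundle.contMDiffAt_totalSpace.2 ⟨contMDiffAt_id, ?_⟩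
    simpa using contMDiffAt_const
  have h2 := (hq.contMDiff_tangentMap (m := ∞) le_rfl).comp h1
  have hP' : SmoothMap (𝓘(ℝ, E).prod 𝓘(ℝ, E →L[ℝ] ℝ)) P := hP
  have h3 := ContMDiff.clm_bundle_apply (F₁ := E) (F₂ := ℝ)
    (E₁ := fun x : M => TangentSpace 𝓘(ℝ, E) x) (E₂ := Bundle.Trivial M ℝ)
    (b := fun w => (P w).1) (ϕ := fun w => (P w).2) hP' h2
  rw [← contMDiff_iff_contDiff]
  intro w
  have h4 := (Bundle.contMDiffAt_totalSpace.1 (h3 w)).2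
  exact h4

/-- A linear form as an alternating `1`-form. -/
abbrev oneForm {V : Type*} [NormedAddCommGroup V] [NormedSpace ℝ V] (l : V →L[ℝ] ℝ) :
    V [⋀^Fin 1]→L[ℝ] ℝ :=
  ContinuousAlternatingMap.ofSubsingleton ℝ V ℝ 0 l

theorem pullCovector_comp {m n : ℕ} {P : Euc n → CotangentBundle E M} (hP : IsPlot P)
    {f : Euc m → Euc n} (hf : ContDiff ℝ ∞ f) (y : Euc m) :
    pullCovector (P ∘ f) y = (pullCovector P (f y)).comp (fderiv ℝ f y) := by
  have h1 : MDifferentiableAt 𝓘(ℝ, Euc n) 𝓘(ℝ, E) (fun w => (P w).1) (f y) :=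
    (contMDiff_base hP).mdifferentiable (by simp) _
  have h2 : MDifferentiableAt 𝓘(ℝ, Euc m) 𝓘(ℝ, Euc n) f y :=
    hf.contMDiff.mdifferentiable (by simp) _
  have h3 := mfderiv_comp y h1 h2
  rw [mfderiv_eq_fderiv] at h3
  ext v
  exact congrArg (fun l : Euc m →L[ℝ] E => (P (f y)).2 (l v)) h3

variable (E M) in
/-- The canonical `1`-form `ϖ` of `T^*M`, given by `ϖ(δp) = ⟨p, δq⟩` for `p` over `q`; on a plot
`P`, `(P^* ϖ)(δu) = ⟨P(u), δq⟩`. -/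
def canonicalForm : DForm (CotangentBundle E M) 1 where
  toFun P _ u := oneForm (pullCovector P u)
  smooth _ hP := (ContinuousAlternatingMap.ofSubsingletonLIE (𝕜 := ℝ) (E := Euc _) (F := ℝ)
    (0 : Fin 1)).toContinuousLinearEquiv.contDiff.comp (contDiff_pullCovector hP)
  compat P hP f hf y := by
    rw [pullCovector_comp hP hf y]
    ext v
    rfl

/-- Every smooth map into a manifold factors near each point through one fixed plot centred at the
image point. -/
theorem exists_local_plot [FiniteDimensional ℝ E] (x : M) :
    ∃ (d : ℕ) (L : Euc d ≃L[ℝ] E) (c : Euc d → M), SmoothMap 𝓘(ℝ, E) c ∧ c 0 = x ∧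
      HasMFDerivAt 𝓘(ℝ, Euc d) 𝓘(ℝ, E) c 0 (L : Euc d →L[ℝ] E) ∧
      ∀ (n : ℕ) (p : Euc n → M) (u : Euc n), SmoothMap 𝓘(ℝ, E) p → p u = x →
        ∃ f : Euc n → Euc d, ContDiff ℝ ∞ f ∧ f u = 0 ∧ p =ᶠ[𝓝 u] c ∘ f := by
  let e := extChartAt 𝓘(ℝ, E) x
  have hsrc : x ∈ e.source := mem_extChartAt_source x
  obtain ⟨k, k1, k2, k3⟩ := exists_confine (u := e.target) (x := e x)
    (extChartAt_target_mem_nhds x)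
  let L : Euc (Module.finrank ℝ E) ≃L[ℝ] E := toEuclidean.symm
  have hk : ContMDiff 𝓘(ℝ, E) 𝓘(ℝ, E) ∞ (fun y => e.symm (k y)) := by
    rw [← contMDiffOn_univ]
    exact (contMDiffOn_extChartAt_symm x).comp k1.contMDiff.contMDiffOn fun y _ => k2 y
  have hA : ContDiff ℝ ∞ (fun w => e x + L w) := contDiff_const.add L.contDiff
  have hc : SmoothMap 𝓘(ℝ, E)
      (fun w => e.symm (k (e x + L w))) := hk.comp hA.contMDiff
  have hc0 : e.symm (k (e x + L 0)) = x := by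
    rw [map_zero, add_zero, k3.self_of_nhds]
    exact e.left_inv hsrc
  refine ⟨_, L, fun w => e.symm (k (e x + L w)), hc, hc0, ⟨hc.continuous.continuousAt, ?_⟩, ?_⟩
  · have hev : (fun w => e (e.symm (k (e x + L w)))) =ᶠ[𝓝 0] fun w => e x + L w := by
      have h0 : Filter.Tendsto (fun w => e x + L w) (𝓝 0) (𝓝 (e x)) := by
        have := hA.continuous.tendsto 0
        simpa using this
      filter_upwards [h0.eventually k3] with w hw
      rw [e.right_inv (k2 _), hw]
      rfl
    have hd : HasFDerivAt (fun w => e x + L w) (L : Euc (Module.finrank ℝ E) →L[ℝ] E) 0 :=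
      L.hasFDerivAt.const_add (e x)
    have hd' := (hd.congr_of_eventuallyEq hev).hasFDerivWithinAt (s := Set.range 𝓘(ℝ, Euc (Module.finrank ℝ E)))
    have hx : extChartAt 𝓘(ℝ, E) (e.symm (k (e x + L 0))) = e := by rw [hc0]
    rw [writtenInExtChartAt, hx]
    exact hd'
  · intro n p u hp hpu
    have hu : ∀ᶠ w in 𝓝 u, p w ∈ e.source ∧ k (e (p w)) = e (p w) := by
      have h1 : ∀ᶠ y in 𝓝 x, y ∈ e.source ∧ k (e y) = e y :=
        (Filter.Eventually.and (extChartAt_source_mem_nhds x)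
          ((continuousAt_extChartAt x).eventually k3))
      have h2 : Filter.Tendsto p (𝓝 u) (𝓝 x) := hpu ▸ hp.continuous.continuousAt
      exact h2.eventually h1
    obtain ⟨g, g1, g2, g3⟩ := exists_confine hu
    have hf : ContDiff ℝ ∞ (fun w => e (p (g w))) := by
      rw [← contMDiff_iff_contDiff, ← contMDiffOn_univ]
      exact (contMDiffOn_extChartAt (I := 𝓘(ℝ, E)) (x := x)).comp
        (hp.comp g1.contMDiff).contMDiffOn fun w _ => by simpa [e] using (g2 w).1
    refine ⟨fun w => L.symm (e (p (g w)) - e x), L.symm.contDiff.comp (hf.sub contDiff_const),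
      ?_, ?_⟩
    · simp only [g3.self_of_nhds, id_eq, hpu, sub_self, map_zero]
    · filter_upwards [g3, hu] with w hw hw'
      simp only [Function.comp_apply, L.apply_symm_apply, add_sub_cancel, hw, id_eq, hw'.2]
      exact (e.left_inv hw'.1).symm

/-- A `1`-form on a manifold has a value, a covector, at every point. -/
theorem exists_covector [FiniteDimensional ℝ E] [DiffeologicalSpace M] [IsManifoldDiffeology E M]
    (α : DForm M 1) (x : M) :
    ∃ μ : TangentSpace 𝓘(ℝ, E) x →L[ℝ] ℝ, ∀ (n : ℕ) (p : Euc n → M) (hp : IsPlot p) (u v : Euc n),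
      p u = x → α.toFun p hp u ![v] = μ (derivAt p u v) := by
  obtain ⟨d, L, c, hc, hc0, hL, hfac⟩ := exists_local_plot (E := E) x
  have hc' : IsPlot c := (IsManifoldDiffeology.isPlot_iff (E := E)).2 hc
  refine ⟨((ContinuousAlternatingMap.ofSubsingleton ℝ _ ℝ (0 : Fin 1)).symm
    (α.toFun c hc' 0)).comp (L.symm : E →L[ℝ] Euc d), fun n p hp u v hu => ?_⟩
  have hp' := (IsManifoldDiffeology.isPlot_iff (E := E)).1 hp
  obtain ⟨f, hf, hfu, hpf⟩ := hfac n p u hp' hu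
  have h1 := α.toFun_germ hp (isPlot_reparam hc' hf) hpf
  rw [α.compat c hc' f hf, hfu] at h1
  have h2 : derivAt p u v = L (fderiv ℝ f u v) := by
    have h3 : HasMFDerivAt 𝓘(ℝ, Euc n) 𝓘(ℝ, Euc d) f u (fderiv ℝ f u) :=
      ((hf.differentiable (by simp)) u).hasFDerivAt.hasMFDerivAt
    have h4 := HasMFDerivAt.comp u (hfu ▸ hL) h3
    have h5 := (h4.congr_of_eventuallyEq hpf).mfderiv
    exact congrArg (fun l : Euc n →L[ℝ] E => l v) h5
  rw [h1, h2]
  change α.toFun c hc' 0 (fderiv ℝ f u ∘ ![v]) =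
    α.toFun c hc' 0 (fun _ => L.symm (L (fderiv ℝ f u v)))
  congr 1
  ext i
  fin_cases i
  simp

/-- The value at the point `x` of a `1`-form on the manifold `M`. -/
def DForm.covectorAt [FiniteDimensional ℝ E] [DiffeologicalSpace M] [IsManifoldDiffeology E M]
    (α : DForm M 1) (x : M) : TangentSpace 𝓘(ℝ, E) x →L[ℝ] ℝ :=
  (exists_covector (E := E) α x).choose

theorem DForm.covectorAt_spec [FiniteDimensional ℝ E] [DiffeologicalSpace M]
    [IsManifoldDiffeology E M] (α : DForm M 1) {n : ℕ} (p : Euc n → M) (hp : IsPlot p)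
    (u v : Euc n) : α.toFun p hp u ![v] =
      α.covectorAt (E := E) (p u) (derivAt p u v) :=
  (exists_covector (E := E) α (p u)).choose_spec n p hp u v rfl

end Manifold

/-! ### Lie groups: translations, coadjoint action, parasymplectic Hamiltonian spaces -/

section LieGroup

variable {E : Type*} [NormedAddCommGroup E] [NormedSpace ℝ E]
  {G : Type*} [TopologicalSpace G] [ChartedSpace E G] [Group G] [LieGroup 𝓘(ℝ, E) ∞ G]

/-- The derivative of a self-map of `G`, all tangent spaces of `G` being `E` by definition. -/
def tderiv {M : Type*} [TopologicalSpace M] [ChartedSpace E M] (f : M → M) (x : M) : E →L[ℝ] E :=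
  mfderiv 𝓘(ℝ, E) 𝓘(ℝ, E) f x

theorem tderiv_chain {M : Type*} [TopologicalSpace M] [ChartedSpace E M] {f g : M → M}
    (hf : ContMDiff 𝓘(ℝ, E) 𝓘(ℝ, E) ∞ f) (hg : ContMDiff 𝓘(ℝ, E) 𝓘(ℝ, E) ∞ g)
    (x y : M) (hy : g x = y) (v : E) :
    tderiv f y (tderiv g x v) = tderiv (fun z => f (g z)) x v := by
  subst hy
  have h := mfderiv_comp x (hf.mdifferentiable (by simp) (g x)) (hg.mdifferentiable (by simp) x)
  exact (congrArg (fun l : E →L[ℝ] E => l v) h).symm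

theorem tderiv_id {M : Type*} [TopologicalSpace M] [ChartedSpace E M] (x : M) :
    tderiv (E := E) (fun z : M => z) x = ContinuousLinearMap.id ℝ E :=
  mfderiv_id

/-- The covector `p`, as a linear form on `E`. -/
def fiberForm {M : Type*} [TopologicalSpace M] [ChartedSpace E M] [IsManifold 𝓘(ℝ, E) ∞ M]
    (p : CotangentBundle E M) : E →L[ℝ] ℝ := p.2

theorem cotangent_ext {M : Type*} [TopologicalSpace M] [ChartedSpace E M]
    [IsManifold 𝓘(ℝ, E) ∞ M] {p p' : CotangentBundle E M} (h : p.1 = p'.1)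
    (h2 : ∀ v : E, fiberForm p v = fiberForm p' v) : p = p' := by
  obtain ⟨x, a⟩ := p
  obtain ⟨y, b⟩ := p'
  obtain rfl : x = y := h
  congr 1
  exact ContinuousLinearMap.ext h2

/-- Left translation of covectors: `gp` for `p ∈ T_q^*G` is the element of `T_{gq}^*G` given by
`⟨gp, v⟩ = ⟨p, g⁻¹v⟩`. -/
def leftTranslate (g : G) (p : CotangentBundle E G) : CotangentBundle E G :=
  ⟨g * p.1, p.2.comp (mfderiv 𝓘(ℝ, E) 𝓘(ℝ, E) (fun x => g⁻¹ * x) (g * p.1))⟩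

/-- Right translation of covectors: `pg` for `p ∈ T_q^*G` is the element of `T_{qg}^*G` given by
`⟨pg, v⟩ = ⟨p, vg⁻¹⟩`. -/
def rightTranslate (p : CotangentBundle E G) (g : G) : CotangentBundle E G :=
  ⟨p.1 * g, p.2.comp (mfderiv 𝓘(ℝ, E) 𝓘(ℝ, E) (fun x => x * g⁻¹) (p.1 * g))⟩

/-- `G` acts on `T^*G` by left translations. -/
instance : MulAction G (CotangentBundle E G) where
  smul := leftTranslate
  one_smul p := by
    refine cotangent_ext (one_mul p.1) fun v => ?_
    change fiberForm p (tderiv (fun x : G => (1 : G)⁻¹ * x) (1 * p.1) v) = fiberForm p v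
    simp only [inv_one, one_mul, tderiv_id, ContinuousLinearMap.id_apply]
  mul_smul g h p := by
    refine cotangent_ext (mul_assoc g h p.1) fun v => ?_
    change fiberForm p (tderiv (fun x : G => (g * h)⁻¹ * x) (g * h * p.1) v) =
      fiberForm p (tderiv (fun x : G => h⁻¹ * x) (h * p.1)
        (tderiv (fun x : G => g⁻¹ * x) (g * (h * p.1)) v))
    rw [tderiv_chain contMDiff_mul_left contMDiff_mul_left _ _ (inv_mul_cancel_left _ _)]
    simp only [mul_inv_rev, mul_assoc]

theorem rightTranslate_one (p : CotangentBundle E G) : rightTranslate p 1 = p := by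
  refine cotangent_ext (mul_one p.1) fun v => ?_
  change fiberForm p (tderiv (fun x : G => x * (1 : G)⁻¹) (p.1 * 1) v) = fiberForm p v
  simp only [inv_one, mul_one, tderiv_id, ContinuousLinearMap.id_apply]

theorem rightTranslate_mul (p : CotangentBundle E G) (g h : G) :
    rightTranslate p (g * h) = rightTranslate (rightTranslate p g) h := by
  refine cotangent_ext (mul_assoc p.1 g h).symm fun v => ?_
  change fiberForm p (tderiv (fun x : G => x * (g * h)⁻¹) (p.1 * (g * h)) v) =
    fiberForm p (tderiv (fun x : G => x * g⁻¹) (p.1 * g)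
      (tderiv (fun x : G => x * h⁻¹) (p.1 * g * h) v))
  rw [tderiv_chain contMDiff_mul_right contMDiff_mul_right _ _ (mul_inv_cancel_right _ _)]
  simp only [mul_inv_rev, mul_assoc]

theorem smul_rightTranslate (g : G) (p : CotangentBundle E G) (h : G) :
    g • rightTranslate p h = rightTranslate (g • p) h := by
  refine cotangent_ext (mul_assoc g p.1 h).symm fun v => ?_
  change fiberForm p (tderiv (fun x : G => x * h⁻¹) (p.1 * h)
      (tderiv (fun x : G => g⁻¹ * x) (g * (p.1 * h)) v)) =
    fiberForm p (tderiv (fun x : G => g⁻¹ * x) (g * p.1)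
      (tderiv (fun x : G => x * h⁻¹) (g * p.1 * h) v))
  rw [tderiv_chain contMDiff_mul_right contMDiff_mul_left _ _ (inv_mul_cancel_left _ _),
    tderiv_chain contMDiff_mul_left contMDiff_mul_right _ _ (mul_inv_cancel_right _ _)]
  simp only [mul_assoc]

/-- The coadjoint action `⟨gμg⁻¹, Z⟩ = ⟨μ, g⁻¹Zg⟩` on the dual of the Lie algebra. -/
def coadjoint (g : G) (μ : GroupLieAlgebra 𝓘(ℝ, E) G →L[ℝ] ℝ) :
    GroupLieAlgebra 𝓘(ℝ, E) G →L[ℝ] ℝ :=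
  μ.comp (show GroupLieAlgebra 𝓘(ℝ, E) G →L[ℝ] GroupLieAlgebra 𝓘(ℝ, E) G from
    mfderiv 𝓘(ℝ, E) 𝓘(ℝ, E) (fun x : G => g⁻¹ * x * g) 1)

/-- The velocity `c'(0)` of a curve `c` in `G` with `c(0) = e`, an element of the Lie algebra. -/
def velocity (c : ℝ → G) : GroupLieAlgebra 𝓘(ℝ, E) G :=
  (derivAt c 0 (1 : ℝ) : E)

section Hamiltonian

variable [DiffeologicalSpace G] [IsManifoldDiffeology E G]
  {X : Type*} [DiffeologicalSpace X] [MulAction G X]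

variable (E) in
/-- For a curve `c` in `G` and a path `γ` in `X`, the map `(s, t) ↦ c(s)(γ(t))` is a plot. -/
theorem isPlot_sweep (hs : DSmooth fun a : G × X => a.1 • a.2) {c : ℝ → G}
    (hc : SmoothMap 𝓘(ℝ, E) c) {γ : ℝ → X} (hγ : DSmooth γ) :
    IsPlot (fun x : Euc 2 => c (x 0) • γ (x 1)) := by
  have h0 : ∀ i : Fin 2, ContDiff ℝ ∞ (fun x : Euc 2 => x i) := fun i => by fun_prop
  refine hs 2 (fun x => (c (x 0), γ (x 1))) ⟨?_, hγ 2 _ (h0 1).isPlot⟩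
  exact (IsManifoldDiffeology.isPlot_iff (E := E)).2 (hc.comp (h0 0).contMDiff)

/-- `(X, σ, Φ)` is a parasymplectic Hamiltonian `G`-space: `G` acts smoothly on the diffeological
space `X`, `σ` is a closed `G`-invariant `2`-form on `X`, and `Φ : X → 𝔤^*` is a smooth
`Ad^*`-equivariant map with `σ(Z_X, ·) = -d⟨Φ(·), Z⟩` for all `Z ∈ 𝔤`. The last condition is
evaluated on paths `γ` in `X`: the vectors `Z_X(γ(t))` and `γ'(t)` are the partial derivatives at
`(0, t)` of the plot `(s, t) ↦ c(s)(γ(t))`, where `c` is any curve in `G` with `c(0) = e` and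
`c'(0) = Z`. -/
structure IsParasymplecticHamiltonian (σ : DForm X 2)
    (Φ : X → (GroupLieAlgebra 𝓘(ℝ, E) G →L[ℝ] ℝ)) : Prop where
  smooth_action : DSmooth fun a : G × X => a.1 • a.2
  closed : ∀ (n : ℕ) (p : Euc n → X) (hp : IsPlot p) (u : Euc n), σ.d.toFun p hp u = 0
  invariant : ∀ g : G, σ.pullback (fun x => g • x)
    (haveI : IsSmoothAction G X := ⟨smooth_action⟩; dSmooth_smul_left g) = σ
  smooth_moment : ∀ Z : GroupLieAlgebra 𝓘(ℝ, E) G, DSmooth fun x => Φ x Z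
  equivariant : ∀ (g : G) (x : X), Φ (g • x) = coadjoint g (Φ x)
  moment : ∀ (c : ℝ → G) (hc : SmoothMap 𝓘(ℝ, E) c), c 0 = 1 →
    ∀ (γ : ℝ → X) (hγ : DSmooth γ) (t : ℝ),
      σ.toFun (fun x : Euc 2 => c (x 0) • γ (x 1)) (isPlot_sweep E smooth_action hc hγ)
          !₂[0, t] ![!₂[1, 0], !₂[0, 1]] =
        - deriv (fun τ => Φ (γ τ) (velocity c)) t

/-- `f` is an isomorphism of parasymplectic Hamiltonian `G`-spaces `(X, σ, Φ) → (Y, σ', Φ')`: an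
equivariant diffeomorphism with `f^* σ' = σ` and `Φ' ∘ f = Φ`. -/
structure IsHamiltonianIso {Y : Type*} [DiffeologicalSpace Y] [MulAction G Y]
    (σ : DForm X 2) (Φ : X → (GroupLieAlgebra 𝓘(ℝ, E) G →L[ℝ] ℝ))
    (σ' : DForm Y 2) (Φ' : Y → (GroupLieAlgebra 𝓘(ℝ, E) G →L[ℝ] ℝ)) (f : X ≃ Y) : Prop where
  smooth : DSmooth f
  smooth_symm : DSmooth f.symm
  equivariant : ∀ (g : G) (x : X), f (g • x) = g • f x
  pullback_form : σ'.pullback f smooth = σ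
  moment : ∀ x, Φ' (f x) = Φ x

end Hamiltonian

/-! ### The reduced space `(T^*G)//H` -/

section Reduction

variable (E) in
/-- The Lie algebra `𝔥 = {Z ∈ 𝔤 : e^{tZ} ∈ H for all t}` of a subgroup `H`, where `t ↦ e^{tZ}` is the
smooth one-parameter subgroup with velocity `Z` (this set is a linear subspace of `𝔤`, so that it
equals its span). -/
def subgroupLieAlgebra (H : Subgroup G) : Submodule ℝ (GroupLieAlgebra 𝓘(ℝ, E) G) :=
  Submodule.span ℝ {Z | ∃ c : ℝ → G, SmoothMap 𝓘(ℝ, E) c ∧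
    (∀ s t, c (s + t) = c s * c t) ∧ velocity c = Z ∧ ∀ t, c t ∈ H}

/-- The moment map `φ(p) = pq⁻¹`, `p ∈ T_q^*G`, of the action of `G` on `T^*G`:
`⟨φ(p), Z⟩ = ⟨p, Zq⟩`. -/
def momentLeft (p : CotangentBundle E G) : GroupLieAlgebra 𝓘(ℝ, E) G →L[ℝ] ℝ :=
  p.2.comp (mfderiv 𝓘(ℝ, E) 𝓘(ℝ, E) (fun x : G => x * p.1) 1)

/-- The moment map `ψ(p) = -(q⁻¹p)|_𝔥`, `p ∈ T_q^*G`, of the action `h(p) = ph⁻¹` of `H` on `T^*G`: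
`⟨ψ(p), Z⟩ = -⟨p, qZ⟩`. -/
def momentRight (H : Subgroup G) (p : CotangentBundle E G) :
    Module.Dual ℝ (subgroupLieAlgebra E H) :=
  -((show GroupLieAlgebra 𝓘(ℝ, E) G →L[ℝ] ℝ from
      p.2.comp (mfderiv 𝓘(ℝ, E) 𝓘(ℝ, E) (fun x : G => p.1 * x) 1)).toLinearMap.domRestrict
    (subgroupLieAlgebra E H))

variable (E) in
/-- The zero level `ψ⁻¹(0)`, with its subset diffeology. -/
def ZeroLevel (H : Subgroup G) : Type _ := {p : CotangentBundle E G // momentRight H p = 0}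

instance (H : Subgroup G) : DiffeologicalSpace (ZeroLevel E H) :=
  inferInstanceAs (DiffeologicalSpace {p : CotangentBundle E G // momentRight H p = 0})

theorem momentRight_smul (H : Subgroup G) (g : G) (p : CotangentBundle E G) :
    momentRight H (g • p) = momentRight H p := by
  ext ⟨Z, hZ⟩
  refine congrArg Neg.neg ?_
  change fiberForm p (tderiv (fun x : G => g⁻¹ * x) (g * p.1)
      (tderiv (fun x : G => g * p.1 * x) 1 Z)) =
    fiberForm p (tderiv (fun x : G => p.1 * x) 1 Z)
  refine (congrArg (fiberForm p)
    (tderiv_chain (E := E) contMDiff_mul_left contMDiff_mul_left _ _ (mul_one _) Z)).trans ?_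
  simp only [mul_assoc, inv_mul_cancel_left]

theorem momentLeft_rightTranslate (p : CotangentBundle E G) (h : G) :
    momentLeft (rightTranslate p h) = momentLeft p := by
  ext Z
  change fiberForm p (tderiv (fun x : G => x * h⁻¹) (p.1 * h)
      (tderiv (fun x : G => x * (p.1 * h)) 1 Z)) =
    fiberForm p (tderiv (fun x : G => x * p.1) 1 Z)
  refine (congrArg (fiberForm p)
    (tderiv_chain (E := E) contMDiff_mul_right contMDiff_mul_right _ _ (one_mul _) Z)).trans ?_
  simp only [mul_assoc, mul_inv_cancel, mul_one]

instance (H : Subgroup G) : MulAction G (ZeroLevel E H) where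
  smul g p := ⟨g • p.1, (momentRight_smul H g p.1).trans p.2⟩
  one_smul p := Subtype.ext (one_smul G p.1)
  mul_smul g h p := Subtype.ext (mul_smul g h p.1)

variable (E) in
/-- Two points of `ψ⁻¹(0)` are equivalent if they lie in the same orbit of the action
`h(p) = ph⁻¹` of `H`. -/
def orbitSetoid (H : Subgroup G) : Setoid (ZeroLevel E H) where
  r p p' := ∃ h ∈ H, p'.1 = rightTranslate p.1 h⁻¹
  iseqv :=
    { refl := fun p => ⟨1, H.one_mem, by rw [inv_one, rightTranslate_one]⟩
      symm := by
        rintro p p' ⟨h, hh, e⟩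
        exact ⟨h⁻¹, H.inv_mem hh, by
          rw [e, ← rightTranslate_mul, inv_inv, inv_mul_cancel, rightTranslate_one]⟩
      trans := by
        rintro p p' p'' ⟨h, hh, e⟩ ⟨k, hk, e'⟩
        exact ⟨k * h, H.mul_mem hk hh, by rw [e', e, ← rightTranslate_mul, mul_inv_rev]⟩ }

variable (E) in
/-- The reduced space `(T^*G)//H = ψ⁻¹(0)/H`, with its subquotient diffeology. -/
def ReducedSpace (H : Subgroup G) : Type _ := Quotient (orbitSetoid E H)

instance (H : Subgroup G) : DiffeologicalSpace (ReducedSpace E H) :=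
  inferInstanceAs (DiffeologicalSpace (Quotient (orbitSetoid E H)))

/-- The residual action `g(pH) = (gp)H` of `G` on `(T^*G)//H`. -/
instance (H : Subgroup G) : MulAction G (ReducedSpace E H) where
  smul g := Quotient.map (fun p => g • p) fun p p' ⟨h, hh, e⟩ =>
    ⟨h, hh, (congrArg (g • ·) e).trans (smul_rightTranslate g p.1 h⁻¹)⟩
  one_smul y := by
    induction y using Quotient.inductionOn with
    | h p => exact congrArg (Quotient.mk _) (one_smul G p)
  mul_smul g h y := by
    induction y using Quotient.inductionOn with
    | h p => exact congrArg (Quotient.mk _) (mul_smul g h p)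

/-- The residual moment map of `(T^*G)//H`, deduced from `φ`. -/
def reducedMoment (H : Subgroup G) : ReducedSpace E H → (GroupLieAlgebra 𝓘(ℝ, E) G →L[ℝ] ℝ) :=
  Quotient.lift (fun p => momentLeft p.1) fun p p' ⟨h, _, e⟩ => by
    rw [e, momentLeft_rightTranslate]

/-- `σ` is the reduced `2`-form of `(T^*G)//H`: its pull-back to `ψ⁻¹(0)` is the restriction of the
`2`-form `dϖ` of `T^*G`. -/
def IsReducedForm (H : Subgroup G) (σ : DForm (ReducedSpace E H) 2) : Prop :=
  σ.pullback (Quotient.mk (orbitSetoid E H)) (dSmooth_mk _) =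
    (canonicalForm E G).d.pullback (fun p : ZeroLevel E H => p.1) (dSmooth_val _)

end Reduction

/-! ### The Hamiltonian structure of `T^*(G/H)` -/

section Coset

/-- Left translations define a smooth action of `G` on `G/H`. -/
theorem isSmoothAction_coset (E : Type*) [NormedAddCommGroup E] [NormedSpace ℝ E]
    {G : Type*} [TopologicalSpace G] [ChartedSpace E G] [Group G] [LieGroup 𝓘(ℝ, E) ∞ G]
    [DiffeologicalSpace G] [IsManifoldDiffeology E G] (H : Subgroup G) :
    IsSmoothAction G (G ⧸ H) where
  dSmooth_smul := fun n p hp x => by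
    obtain ⟨q, hq, hqp⟩ := hp.2 x
    have h1 := (IsManifoldDiffeology.isPlot_iff (E := E)).1 hp.1
    have h2 := (IsManifoldDiffeology.isPlot_iff (E := E)).1 hq
    refine ⟨fun y => (p y).1 * q y, (IsManifoldDiffeology.isPlot_iff (E := E)).2 (h1.mul h2), ?_⟩
    filter_upwards [hqp] with y hy
    change _ = (p y).1 • (p y).2
    rw [← hy]
    rfl

/-- The orbit map `g ↦ g(y)` of `y ∈ T^*(X)` is smooth. -/
theorem dSmooth_orbit (E : Type*) [NormedAddCommGroup E] [NormedSpace ℝ E]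
    {G : Type*} [TopologicalSpace G] [ChartedSpace E G] [Group G] [LieGroup 𝓘(ℝ, E) ∞ G]
    [DiffeologicalSpace G] [IsManifoldDiffeology E G]
    {X : Type*} [DiffeologicalSpace X] [MulAction G X] [IsSmoothAction G X]
    (y : DCotangent X) : DSmooth fun g : G => g • y := by
  obtain ⟨⟨x, α⟩, rfl⟩ := Quotient.exists_rep y
  intro n g hg
  refine dSmooth_mk (cotSetoid X) n (fun u => (g u • x, α.push (g u))) ⟨?_, ?_⟩
  · exact IsSmoothAction.dSmooth_smul (G := G) (X := X) n (fun u => (g u, x)) ⟨hg, isPlot_const⟩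
  · intro m p hp
    let T : Euc (n + m) ≃L[ℝ] Euc n × Euc m := ContinuousLinearEquiv.ofFinrankEq (by simp)
    have hT1 : ContDiff ℝ ∞ (fun z => (T z).1) := contDiff_fst.comp T.contDiff
    have hT2 : ContDiff ℝ ∞ (fun z => (T z).2) := contDiff_snd.comp T.contDiff
    have hginv : IsPlot (fun z => (g (T z).1)⁻¹) := by
      refine (IsManifoldDiffeology.isPlot_iff (E := E)).2 ?_
      exact (((IsManifoldDiffeology.isPlot_iff (E := E)).1 hg).comp hT1.contMDiff).inv
    have hB : IsPlot (fun z => (g (T z).1)⁻¹ • p (T z).2) :=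
      IsSmoothAction.dSmooth_smul (G := G) (X := X) (n + m) (fun z => ((g (T z).1)⁻¹, p (T z).2))
        ⟨hginv, isPlot_reparam hp hT2⟩
    let J : Euc m →L[ℝ] Euc (n + m) :=
      (T.symm : Euc n × Euc m →L[ℝ] Euc (n + m)).comp (ContinuousLinearMap.inr ℝ (Euc n) (Euc m))
    have key : ∀ w : Euc n × Euc m, (α.push (g w.1)).toFun p hp w.2 =
        (α.toFun _ hB (T.symm w)).compContinuousLinearMap J := by
      rintro ⟨u, v⟩
      have hι : ContDiff ℝ ∞ (fun v' : Euc m => T.symm (u, v')) :=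
        T.symm.contDiff.comp (contDiff_const.prodMk contDiff_id)
      have hd : fderiv ℝ (fun v' : Euc m => T.symm (u, v')) v = J :=
        (T.symm.hasFDerivAt.comp v (hasFDerivAt_prodMk_right u v)).fderiv
      have h := α.compat _ hB _ hι v
      rw [hd] at h
      rw [← h]
      refine congrFun (α.toFun_congr (funext fun v' => ?_) _ _) v
      simp
    change ContDiff ℝ ∞ fun w : Euc n × Euc m => (α.push (g w.1)).toFun p hp w.2
    simp only [key]
    exact (ContinuousAlternatingMap.compContinuousLinearMapCLM J).contDiff.comp
      ((α.smooth _ hB).comp T.symm.contDiff)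

/-- The moment map of the action of `G` on `T^*(X)`: `Φ(y)` is the value at `e` of the `1`-form
`ŷ^* Liouv` on `G`, where `ŷ(g) = g(y)`. -/
def cotangentMoment (E : Type*) [NormedAddCommGroup E] [NormedSpace ℝ E] [FiniteDimensional ℝ E]
    {G : Type*} [TopologicalSpace G] [ChartedSpace E G] [Group G] [LieGroup 𝓘(ℝ, E) ∞ G]
    [DiffeologicalSpace G] [IsManifoldDiffeology E G]
    {X : Type*} [DiffeologicalSpace X] [MulAction G X] [IsSmoothAction G X]
    (y : DCotangent X) : GroupLieAlgebra 𝓘(ℝ, E) G →L[ℝ] ℝ :=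
  ((liouville X).pullback (fun g : G => g • y) (dSmooth_orbit E y)).covectorAt (E := E) 1

end Coset

end LieGroup

end DiffeoKMS

end

/-!
In the right trivialisation `T^*G ≅ G × 𝔤^*`, `p ↦ (q, pq⁻¹)`, the canonical form is
`⟨μ, (δq)q⁻¹⟩`, the group `H` acts on the factor `G` only, and `ψ(p) = 0` says that `μ = pq⁻¹` vanishes
on `Ad(q)𝔥`. If `H` is dense then `Ad(q)𝔥 = 𝔥` for all `q ∈ G`, since the stabiliser of a subspace
is closed (`Ad_mem_subgroupLieAlgebra`). Thus `ψ⁻¹(0) = G × ann 𝔥`, and the reduced space is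
`G/H × ann 𝔥`.

The cotangent space of `G/H` is the same space. A `1`-form on `G/H` pulls back to a form on `G`
that is invariant under right translation by `H`, hence by `G`, by density (`rightValue_eq`); as
it vanishes on the curves in `H`, it is the right-invariant form of some `ν ∈ ann 𝔥`. Conversely
the right-invariant form of `ν ∈ ann 𝔥` descends to `G/H` (`cosetForm`): two plots of `G` with the
same projection differ by a smooth map with values in `H`, and the logarithmic derivative of such
a map takes its values in `𝔥` (`rlog_mem_subgroupLieAlgebra`). Hence `Ω¹(G/H) ≅ ann 𝔥`, a form is
determined by its value at any one point, and `T^*(G/H) = G/H × ann 𝔥`.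

The statement about smooth maps with values in `H` is where an arbitrary subgroup needs care: the
velocities at the identity of smooth curves in `H` form a vector space, and one smooth
map `F` from this space into `H` has all of them as derivatives at `0`. Solving an ordinary differential equation in its domain
gives integral curves of left-invariant vector fields inside `H`, that is, one-parameter subgroups
(`exists_oneParameter`).

The same argument shows that `ϖ` itself, restricted to `ψ⁻¹(0)`, descends to a `1`-form on the
reduced space (`reducedPotential`). The reduced `2`-form is its differential, and is unique
because forms on a quotient are determined by their pull-backs. An action that preserves a
`1`-form `θ` is Hamiltonian for `dθ` with the moment map `Z ↦ θ(Z_X)`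
(`isParasymplecticHamiltonian_of_exact`), which gives the Hamiltonian structure of the reduced
space. The map `(q, μ) ↦ (qH, μ)` carries the Liouville form to this potential, hence the
`2`-forms and the moment maps to each other, and transports the Hamiltonian structure to
`T^*(G/H)`.
-/

set_option linter.unusedSectionVars false

namespace DiffeoKMS

/-! ### The right logarithmic derivative and the adjoint representation -/

section Calculus

variable {E : Type*} [NormedAddCommGroup E] [NormedSpace ℝ E]
  {V : Type*} [NormedAddCommGroup V] [NormedSpace ℝ V]
  {W : Type*} [NormedAddCommGroup W] [NormedSpace ℝ W]
  {G : Type*} [TopologicalSpace G] [ChartedSpace E G]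

/-- The derivative of a map `V → G`, all tangent spaces of `G` being `E` by definition. -/
noncomputable def vderiv (p : V → G) (u : V) : V →L[ℝ] E := derivAt p u

variable {p q : V → G} {u : V}

theorem vderiv_const (g : G) : vderiv (E := E) (fun _ : V => g) u = 0 :=
  mfderiv_const

theorem vderiv_comp_left {φ : G → G} (hφ : MDifferentiableAt 𝓘(ℝ, E) 𝓘(ℝ, E) φ (p u))
    (hp : MDifferentiableAt 𝓘(ℝ, V) 𝓘(ℝ, E) p u) (v : V) :
    vderiv (fun w => φ (p w)) u v = tderiv (E := E) φ (p u) (vderiv p u v) :=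
  congrArg (fun l : V →L[ℝ] E => l v) (mfderiv_comp u hφ hp)

theorem vderiv_comp_right {f : W → V} {y : W}
    (hp : MDifferentiableAt 𝓘(ℝ, V) 𝓘(ℝ, E) p (f y)) (hf : DifferentiableAt ℝ f y) (v : W) :
    vderiv (E := E) (fun w => p (f w)) y v = vderiv p (f y) (fderiv ℝ f y v) := by
  have h := mfderiv_comp y hp hf.mdifferentiableAt
  rw [mfderiv_eq_fderiv] at h
  exact congrArg (fun l : W →L[ℝ] E => l v) h

variable [Group G] [LieGroup 𝓘(ℝ, E) ∞ G]

theorem vderiv_mul (hp : MDifferentiableAt 𝓘(ℝ, V) 𝓘(ℝ, E) p u)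
    (hq : MDifferentiableAt 𝓘(ℝ, V) 𝓘(ℝ, E) q u) (v : V) :
    vderiv (fun w => p w * q w) u v =
      tderiv (E := E) (fun x => x * q u) (p u) (vderiv p u v) +
      tderiv (fun x => p u * x) (q u) (vderiv q u v) := by
  have hm : MDifferentiableAt (𝓘(ℝ, E).prod 𝓘(ℝ, E)) 𝓘(ℝ, E) (fun x : G × G => x.1 * x.2)
      (p u, q u) := (contMDiff_mul 𝓘(ℝ, E) ∞).mdifferentiable (by simp) _
  have h1 := mfderiv_comp u (f := fun w => (p w, q w)) hm (hp.prodMk hq)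
  have h2 := mfderiv_prod_eq_add_apply (I := 𝓘(ℝ, E)) (I' := 𝓘(ℝ, E)) (I'' := 𝓘(ℝ, E))
    (v := (vderiv (E := E) p u v, vderiv (E := E) q u v)) hm
  rw [mfderiv_prodMk hp hq] at h1
  exact (congrArg (fun l : V →L[ℝ] E => l v) h1).trans h2

/-- The adjoint representation: `Ad g` is the derivative of `x ↦ g x g⁻¹` at the identity. -/
noncomputable def Ad (g : G) : E →L[ℝ] E := tderiv (fun x : G => g * x * g⁻¹) 1

theorem contMDiff_conj (g : G) :
    ContMDiff 𝓘(ℝ, E) 𝓘(ℝ, E) ∞ (fun x : G => g * x * g⁻¹) :=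
  (contMDiff_mul_right (a := g⁻¹)).comp (contMDiff_mul_left (a := g))

theorem Ad_one (v : E) : Ad (1 : G) v = v := by
  simp only [Ad, one_mul, inv_one, mul_one, tderiv_id, ContinuousLinearMap.id_apply]

theorem Ad_mul (g h : G) (v : E) : Ad (g * h) v = Ad g (Ad h v) := by
  rw [Ad, Ad, Ad, tderiv_chain (contMDiff_conj g) (contMDiff_conj h) _ _ (by simp)]
  simp only [mul_inv_rev, mul_assoc]

theorem Ad_inv_Ad (g : G) (v : E) : Ad g⁻¹ (Ad g v) = v := by
  rw [← Ad_mul, inv_mul_cancel, Ad_one]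

theorem Ad_Ad_inv (g : G) (v : E) : Ad g (Ad g⁻¹ v) = v := by
  rw [← Ad_mul, mul_inv_cancel, Ad_one]

/-- The right logarithmic derivative `δp ↦ (δp) p⁻¹ ∈ 𝔤` of a map `p : V → G`. -/
noncomputable def rlog (p : V → G) (u : V) : V →L[ℝ] E :=
  (tderiv (fun x => x * (p u)⁻¹) (p u)).comp (vderiv p u)

theorem rlog_apply (p : V → G) (u v : V) :
    rlog (E := E) p u v = tderiv (fun x => x * (p u)⁻¹) (p u) (vderiv p u v) := rfl

theorem rlog_const (g : G) : rlog (E := E) (fun _ : V => g) u = 0 := by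
  rw [rlog, vderiv_const, ContinuousLinearMap.comp_zero]

theorem rlog_of_eq_one (h : p u = 1) : rlog (E := E) p u = vderiv p u := by
  ext v
  rw [rlog_apply, h]
  simp only [inv_one, mul_one, tderiv_id, ContinuousLinearMap.id_apply]

/-- The velocity is recovered from the logarithmic derivative by right translation. -/
theorem vderiv_eq_rlog (p : V → G) (u v : V) :
    vderiv (E := E) p u v = tderiv (fun x => x * p u) 1 (rlog p u v) := by
  rw [rlog_apply, tderiv_chain contMDiff_mul_right contMDiff_mul_right _ _ (mul_inv_cancel _)]
  simp only [inv_mul_cancel_right, tderiv_id, ContinuousLinearMap.id_apply]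

/-- The logarithmic derivative as the derivative of a map with value `1` at the point in question,
so that all derivatives are taken in the fixed tangent space at the identity. -/
theorem rlog_eq_vderiv (hp : MDifferentiableAt 𝓘(ℝ, V) 𝓘(ℝ, E) p u) :
    rlog (E := E) p u = vderiv (fun w => p w * (p u)⁻¹) u := by
  ext v
  exact (vderiv_comp_left (φ := fun x => x * (p u)⁻¹)
    (contMDiff_mul_right.mdifferentiable (n := ∞) (by simp) _) hp v).symm

theorem rlog_comp_right {f : W → V} {y : W}
    (hp : MDifferentiableAt 𝓘(ℝ, V) 𝓘(ℝ, E) p (f y)) (hf : DifferentiableAt ℝ f y) (v : W) :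
    rlog (E := E) (fun w => p (f w)) y v = rlog p (f y) (fderiv ℝ f y v) := by
  rw [rlog_apply, vderiv_comp_right hp hf, rlog_apply]

/-- The cocycle rule `δ(pq)(pq)⁻¹ = (δp)p⁻¹ + Ad(p)((δq)q⁻¹)`. -/
theorem rlog_mul (hp : MDifferentiableAt 𝓘(ℝ, V) 𝓘(ℝ, E) p u)
    (hq : MDifferentiableAt 𝓘(ℝ, V) 𝓘(ℝ, E) q u) (v : V) :
    rlog (fun w => p w * q w) u v = rlog (E := E) p u v + Ad (p u) (rlog q u v) := by
  simp only [rlog_apply]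
  rw [vderiv_mul hp hq, map_add, Ad,
    tderiv_chain contMDiff_mul_right contMDiff_mul_right _ _ rfl,
    tderiv_chain contMDiff_mul_right contMDiff_mul_left _ _ rfl,
    tderiv_chain (contMDiff_conj _) contMDiff_mul_right _ _ (mul_inv_cancel _)]
  simp only [mul_inv_rev, mul_assoc, mul_inv_cancel_left]

theorem rlog_mul_right (hp : MDifferentiableAt 𝓘(ℝ, V) 𝓘(ℝ, E) p u) (g : G) :
    rlog (E := E) (fun w => p w * g) u = rlog p u := by
  ext v
  rw [rlog_mul hp mdifferentiableAt_const, rlog_const, zero_apply, map_zero, add_zero]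

theorem rlog_mul_left (hp : MDifferentiableAt 𝓘(ℝ, V) 𝓘(ℝ, E) p u) (g : G) (v : V) :
    rlog (fun w => g * p w) u v = Ad (E := E) g (rlog p u v) := by
  rw [rlog_mul mdifferentiableAt_const hp, rlog_const, zero_apply, zero_add]

theorem mdifferentiableAt_inv' (hp : MDifferentiableAt 𝓘(ℝ, V) 𝓘(ℝ, E) p u) :
    MDifferentiableAt 𝓘(ℝ, V) 𝓘(ℝ, E) (fun w => (p w)⁻¹) u :=
  ((contMDiff_inv 𝓘(ℝ, E) ∞).mdifferentiable (by simp) (p u)).comp u hp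

theorem rlog_inv (hp : MDifferentiableAt 𝓘(ℝ, V) 𝓘(ℝ, E) p u) (v : V) :
    rlog (fun w => (p w)⁻¹) u v = - Ad (E := E) (p u)⁻¹ (rlog p u v) := by
  have h := rlog_mul (mdifferentiableAt_inv' hp) hp v
  simp only [inv_mul_cancel, rlog_const, zero_apply] at h
  exact eq_neg_of_add_eq_zero_left h.symm

theorem SmoothMap.mdiffAt (hp : SmoothMap 𝓘(ℝ, E) p) (u : V) :
    MDifferentiableAt 𝓘(ℝ, V) 𝓘(ℝ, E) p u := hp.mdifferentiable (by simp) u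

/-- A curve as a plot of the test space `ℝ¹`. -/
theorem rlog_comp_coord {c : ℝ → G} (hc : SmoothMap 𝓘(ℝ, E) c) :
    rlog (E := E) (fun x : Euc 1 => c (x 0)) 0 (EuclideanSpace.single 0 1) = rlog c 0 1 := by
  let l : Euc 1 →L[ℝ] ℝ := EuclideanSpace.proj (0 : Fin 1)
  have h : rlog (E := E) (fun x => c (l x)) 0 (EuclideanSpace.single 0 1) =
      rlog c (l 0) (fderiv ℝ l 0 (EuclideanSpace.single 0 1)) :=
    rlog_comp_right (hc.mdiffAt _) l.differentiableAt _
  rw [ContinuousLinearMap.fderiv, map_zero] at h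
  simpa [l] using h

theorem coadjoint_apply (g : G) (μ : GroupLieAlgebra 𝓘(ℝ, E) G →L[ℝ] ℝ) (v : E) :
    (show E →L[ℝ] ℝ from coadjoint g μ) v = (show E →L[ℝ] ℝ from μ) (Ad g⁻¹ v) := by
  have : (Ad g⁻¹ : E →L[ℝ] E) = tderiv (fun x : G => g⁻¹ * x * g) 1 := by
    rw [Ad, inv_inv]
  rw [this]
  rfl

end Calculus

/-! ### Smoothness of the logarithmic derivative, of the adjoint representation, of covectors -/

section Smooth
variable {E : Type*} [NormedAddCommGroup E] [NormedSpace ℝ E]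
  {V : Type*} [NormedAddCommGroup V] [NormedSpace ℝ V]
  {G : Type*} [TopologicalSpace G] [ChartedSpace E G] [Group G] [LieGroup 𝓘(ℝ, E) ∞ G]

/-- By `rlog_eq_vderiv`, this is smoothness in `u` of the derivative at `u` of the family
`w ↦ p(w) p(u)⁻¹`. -/
theorem contDiff_rlog {p : V → G} (hp : SmoothMap 𝓘(ℝ, E) p) :
    ContDiff ℝ ∞ (rlog (E := E) p) := by
  rw [contDiff_iff_contDiffAt]
  intro u₀
  have h0 : ContMDiff (𝓘(ℝ, V).prod 𝓘(ℝ, V)) 𝓘(ℝ, E) ∞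
      (Function.uncurry fun u w : V => p w * (p u)⁻¹) :=
    (hp.comp contMDiff_snd).mul (hp.comp contMDiff_fst).inv
  have h1 := ContMDiffAt.mfderiv (x₀ := u₀) (fun u w : V => p w * (p u)⁻¹) id
    (h0 _) contMDiffAt_id (m := ∞) (by simp)
  rw [← contMDiffAt_iff_contDiffAt]
  refine h1.congr_of_eventuallyEq (Filter.Eventually.of_forall fun u => ?_)
  -- the base point stays at the identity, so that the coordinate changes are trivial
  refine Eq.symm ((inTangentCoordinates_eq (I := 𝓘(ℝ, V)) (I' := 𝓘(ℝ, E)) id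
    (fun u => p u * (p u)⁻¹) (fun u => vderiv (E := E) (fun w => p w * (p u)⁻¹) u)
    (by rw [chartAt_self_eq]; trivial) (by simp [mem_chart_source])).trans ?_)
  ext v
  rw [rlog_eq_vderiv (hp.mdiffAt u)]
  simp only [ContinuousLinearMap.comp_apply, id_eq, mul_inv_cancel]
  rw [tangentBundleCore_coordChange_model_space]
  exact (tangentBundleCore 𝓘(ℝ, E) G).coordChange_self (achart E (1 : G)) 1
    (mem_achart_source E 1) (vderiv (E := E) (fun w => p w * (p u)⁻¹) u v)

theorem contMDiff_Ad : ContMDiff 𝓘(ℝ, E) 𝓘(ℝ, E →L[ℝ] E) ∞ (Ad (E := E) (G := G)) := by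
  intro x₀
  have h0 : ContMDiff (𝓘(ℝ, E).prod 𝓘(ℝ, E)) 𝓘(ℝ, E) ∞
      (Function.uncurry fun g x : G => g * x * g⁻¹) :=
    (contMDiff_fst.mul contMDiff_snd).mul contMDiff_fst.inv
  have h1 := ContMDiffAt.mfderiv (x₀ := x₀) (fun g x : G => g * x * g⁻¹) (fun _ => 1)
    (h0 _) contMDiffAt_const (m := ∞) (by simp)
  refine h1.congr_of_eventuallyEq (Filter.Eventually.of_forall fun g => ?_)
  refine Eq.symm ((inTangentCoordinates_eq (I := 𝓘(ℝ, E)) (I' := 𝓘(ℝ, E)) (fun _ => (1 : G))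
    (fun g : G => g * 1 * g⁻¹) (fun g => Ad (E := E) g)
    (mem_chart_source _ _) (by simp [mem_chart_source])).trans ?_)
  have h2 := fun v => (tangentBundleCore 𝓘(ℝ, E) G).coordChange_self (achart E (1 : G)) 1
    (mem_achart_source E 1) v
  ext v
  simp only [ContinuousLinearMap.comp_apply, mul_one, mul_inv_cancel]
  exact (h2 _).trans (congrArg (Ad g) (h2 v))

theorem continuous_Ad : Continuous (Ad (E := E) (G := G)) := contMDiff_Ad.continuous

/-- The map of fibres over `x` of the trivialisation of the tangent bundle around `x₀`, as a map of
`E`. -/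
noncomputable def tangentTriv {M : Type*} [TopologicalSpace M] [ChartedSpace E M]
    [IsManifold 𝓘(ℝ, E) ∞ M] (x₀ x : M) : E →L[ℝ] E :=
  (trivializationAt E (TangentSpace 𝓘(ℝ, E)) x₀).continuousLinearMapAt ℝ x

/-- The inverse of `tangentTriv`, for `x` in the domain of the chart at `x₀`. -/
noncomputable def tangentTrivSymm {M : Type*} [TopologicalSpace M] [ChartedSpace E M]
    [IsManifold 𝓘(ℝ, E) ∞ M] (x₀ x : M) : E →L[ℝ] E :=
  (trivializationAt E (TangentSpace 𝓘(ℝ, E)) x₀).symmL ℝ x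

theorem tangentTriv_symm {M : Type*} [TopologicalSpace M] [ChartedSpace E M]
    [IsManifold 𝓘(ℝ, E) ∞ M] {x₀ x : M} (h : x ∈ (chartAt E x₀).source) (v : E) :
    tangentTriv x₀ x (tangentTrivSymm x₀ x v) = v :=
  (trivializationAt E (TangentSpace 𝓘(ℝ, E)) x₀).continuousLinearMapAt_symmL
    (by simpa using h) v

theorem tangentTrivSymm_triv {M : Type*} [TopologicalSpace M] [ChartedSpace E M]
    [IsManifold 𝓘(ℝ, E) ∞ M] {x₀ x : M} (h : x ∈ (chartAt E x₀).source) (v : E) :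
    tangentTrivSymm x₀ x (tangentTriv x₀ x v) = v :=
  (trivializationAt E (TangentSpace 𝓘(ℝ, E)) x₀).symmL_continuousLinearMapAt
    (by simpa using h) v

/-- In a trivialisation of the tangent bundle, the derivative of right translation by `q(u)`
depends smoothly on `u`. -/
theorem contDiffAt_tangentTriv_comp {q : V → G} (hq : SmoothMap 𝓘(ℝ, E) q) (u₀ : V) :
    ContDiffAt ℝ ∞ (fun u => (tangentTriv (E := E) (q u₀) (q u)).comp
      (tderiv (fun x => x * q u) 1)) u₀ := by
  have h0 : ContMDiff (𝓘(ℝ, V).prod 𝓘(ℝ, E)) 𝓘(ℝ, E) ∞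
      (Function.uncurry fun (u : V) (x : G) => x * q u) :=
    contMDiff_snd.mul (hq.comp contMDiff_fst)
  have h1 := ContMDiffAt.mfderiv (x₀ := u₀) (fun (u : V) (x : G) => x * q u) (fun _ => 1)
    (h0 _) contMDiffAt_const (m := ∞) (by simp)
  rw [← contMDiffAt_iff_contDiffAt]
  have h3 : ∀ᶠ u in 𝓝 u₀, q u ∈ (chartAt E (q u₀)).source :=
    hq.continuous.continuousAt.eventually (chart_source_mem_nhds E (q u₀))
  refine h1.congr_of_eventuallyEq (h3.mono fun u hu => ?_)
  refine Eq.symm ((inTangentCoordinates_eq (I := 𝓘(ℝ, E)) (I' := 𝓘(ℝ, E)) (fun _ => (1 : G))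
      (fun u => 1 * q u) (fun u => tderiv (E := E) (fun x => x * q u) 1)
      (mem_chart_source _ _) (by simpa using hu)).trans ?_)
  have h2 := fun v => (tangentBundleCore 𝓘(ℝ, E) G).coordChange_self (achart E (1 : G)) 1
      (mem_achart_source E 1) v
  have h4 := TangentBundle.continuousLinearMapAt_trivializationAt_eq_core (I := 𝓘(ℝ, E)) hu
  have h5 : tangentTriv (E := E) (q u₀) (q u) = _ := h4
  ext v
  simp only [ContinuousLinearMap.comp_apply, one_mul, h5]
  exact congrArg _ (congrArg (tderiv (fun x => x * q u) 1) (h2 v))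

/-- A map to `T^*M` is smooth if its base point is, and its covector is in the trivialisation dual
to `tangentTriv`. -/
theorem contMDiffAt_cotangent_iff {M : Type*} [TopologicalSpace M] [ChartedSpace E M]
    [IsManifold 𝓘(ℝ, E) ∞ M] (P : V → CotangentBundle E M) (u₀ : V) :
    ContMDiffAt 𝓘(ℝ, V) (𝓘(ℝ, E).prod 𝓘(ℝ, E →L[ℝ] ℝ)) ∞ P u₀ ↔
      ContMDiffAt 𝓘(ℝ, V) 𝓘(ℝ, E) ∞ (fun u => (P u).1) u₀ ∧
      ContDiffAt ℝ ∞ (fun u => (fiberForm (P u)).comp (tangentTrivSymm (P u₀).1 (P u).1)) u₀ := by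
  rw [contMDiffAt_hom_bundle, ← contMDiffAt_iff_contDiffAt]
  refine and_congr_right fun _ => iff_of_eq
    (congrArg (fun f => ContMDiffAt 𝓘(ℝ, V) 𝓘(ℝ, E →L[ℝ] ℝ) ∞ f u₀) ?_)
  funext u
  simp only [ContinuousLinearMap.inCoordinates]
  ext v
  simp
  rfl

end Smooth

/-! ### The right trivialisation of the cotangent bundle of a Lie group -/

section CotangentGroup
variable {E : Type*} [NormedAddCommGroup E] [NormedSpace ℝ E]
  {V : Type*} [NormedAddCommGroup V] [NormedSpace ℝ V]
  {G : Type*} [TopologicalSpace G] [ChartedSpace E G] [Group G] [LieGroup 𝓘(ℝ, E) ∞ G]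

/-- The momentum `pq⁻¹` of `p ∈ T_q^*G`. It is `momentLeft p`, read as a linear form on `E`, the
model space, which is the Lie algebra of `G` by definition. -/
noncomputable def momentum (p : CotangentBundle E G) : E →L[ℝ] ℝ :=
  (fiberForm p).comp (tderiv (fun x : G => x * p.1) 1)

/-- The covector `μq` at `q` of momentum `μ`. -/
noncomputable def ofMomentum (q : G) (μ : E →L[ℝ] ℝ) : CotangentBundle E G :=
  ⟨q, (show E →L[ℝ] ℝ from μ.comp (tderiv (fun x : G => x * q⁻¹) q))⟩

theorem tderiv_mul_right_inv_left (q : G) (v : E) :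
    tderiv (fun x : G => x * q⁻¹) q (tderiv (fun x : G => x * q) 1 v) = v := by
  rw [tderiv_chain contMDiff_mul_right contMDiff_mul_right _ _ (one_mul q)]
  simp only [mul_inv_cancel_right, tderiv_id, ContinuousLinearMap.id_apply]

theorem tderiv_mul_right_inv_right (q : G) (v : E) :
    tderiv (fun x : G => x * q) 1 (tderiv (fun x : G => x * q⁻¹) q v) = v := by
  rw [tderiv_chain contMDiff_mul_right contMDiff_mul_right _ _ (mul_inv_cancel q)]
  simp only [inv_mul_cancel_right, tderiv_id, ContinuousLinearMap.id_apply]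

theorem momentum_ofMomentum (q : G) (μ : E →L[ℝ] ℝ) : momentum (ofMomentum q μ) = μ := by
  ext v
  exact congrArg μ (tderiv_mul_right_inv_left q v)

theorem fiberForm_apply (p : CotangentBundle E G) (v : E) :
    fiberForm p v = momentum p (tderiv (fun x : G => x * p.1⁻¹) p.1 v) := by
  rw [momentum, ContinuousLinearMap.comp_apply, tderiv_mul_right_inv_right]

theorem cotangent_ext_momentum {p p' : CotangentBundle E G} (h : p.1 = p'.1)
    (h' : momentum p = momentum p') : p = p' :=
  cotangent_ext h fun v => by rw [fiberForm_apply, fiberForm_apply, h, h']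

/-- In the right trivialisation `T^*G ≅ G × 𝔤^*`, smoothness may be checked on the two
components. -/
theorem smoothMap_cotangent_iff [CompleteSpace E] (P : V → CotangentBundle E G) :
    SmoothMap (𝓘(ℝ, E).prod 𝓘(ℝ, E →L[ℝ] ℝ)) P ↔
      SmoothMap 𝓘(ℝ, E) (fun u => (P u).1) ∧ ContDiff ℝ ∞ fun u => momentum (P u) := by
  have hmem : ∀ u₀, SmoothMap 𝓘(ℝ, E) (fun u => (P u).1) →
      ∀ᶠ u in 𝓝 u₀, (P u).1 ∈ (chartAt E (P u₀).1).source := fun u₀ hq =>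
    hq.continuous.continuousAt.eventually (chart_source_mem_nhds E (P u₀).1)
  constructor
  · intro hP
    have hq : SmoothMap 𝓘(ℝ, E) (fun u => (P u).1) := (Bundle.contMDiff_proj _).comp hP
    refine ⟨hq, contDiff_iff_contDiffAt.2 fun u₀ => ?_⟩
    have h1 := ((contMDiffAt_cotangent_iff P u₀).1 (hP u₀)).2
    refine (h1.clm_comp (contDiffAt_tangentTriv_comp hq u₀)).congr_of_eventuallyEq
      ((hmem u₀ hq).mono fun u hu => ?_)
    ext v
    exact congrArg (fiberForm (P u)) (tangentTrivSymm_triv hu _).symm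
  · rintro ⟨hq, hμ⟩ u₀
    refine (contMDiffAt_cotangent_iff P u₀).2 ⟨hq u₀, ?_⟩
    -- the matrix of the right translation by `q(u)` in the trivialisation is invertible
    have hA := contDiffAt_tangentTriv_comp hq u₀
    set A := fun u => (tangentTriv (E := E) (P u₀).1 (P u).1).comp
      (tderiv (fun x => x * (P u).1) 1) with hAdef
    let B := fun u => (tderiv (E := E) (fun x => x * (P u).1⁻¹) (P u).1).comp
      (tangentTrivSymm (P u₀).1 (P u).1)
    have hAB : ∀ u, (P u).1 ∈ (chartAt E (P u₀).1).source →
        (∀ v, B u (A u v) = v) ∧ ∀ v, A u (B u v) = v := fun u hu =>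
      ⟨fun v => (congrArg _ (tangentTrivSymm_triv hu _)).trans (tderiv_mul_right_inv_left _ v),
        fun v => (congrArg _ (tderiv_mul_right_inv_right _ _)).trans (tangentTriv_symm hu v)⟩
    have hu₀ := (hmem u₀ hq).self_of_nhds
    have hinv : ∀ u, (P u).1 ∈ (chartAt E (P u₀).1).source → (A u).inverse = B u := fun u hu =>
      ContinuousLinearMap.inverse_eq (ContinuousLinearMap.ext (hAB u hu).2)
        (ContinuousLinearMap.ext (hAB u hu).1)
    have he : ContDiffAt ℝ ∞ (ContinuousLinearMap.inverse (R := ℝ) (M := E) (M₂ := E)) (A u₀) :=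
      contDiffAt_map_inverse (ContinuousLinearEquiv.equivOfInverse (A u₀) (B u₀)
        (hAB u₀ hu₀).1 (hAB u₀ hu₀).2)
    have hB : ContDiffAt ℝ ∞ (fun u => (A u).inverse) u₀ := he.comp u₀ hA
    refine (hμ.contDiffAt.clm_comp hB).congr_of_eventuallyEq ((hmem u₀ hq).mono fun u hu => ?_)
    dsimp only
    rw [hinv u hu]
    ext v
    exact fiberForm_apply (P u) _

end CotangentGroup

section Momentum
variable {E : Type*} [NormedAddCommGroup E] [NormedSpace ℝ E]
  {G : Type*} [TopologicalSpace G] [ChartedSpace E G] [Group G] [LieGroup 𝓘(ℝ, E) ∞ G]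

theorem isPlot_cotangent_iff [CompleteSpace E] {n : ℕ} (P : Euc n → CotangentBundle E G) :
    IsPlot P ↔ SmoothMap 𝓘(ℝ, E) (fun u => (P u).1) ∧ ContDiff ℝ ∞ fun u => momentum (P u) :=
  smoothMap_cotangent_iff P

/-- The canonical `1`-form in the right trivialisation: `⟨p, δq⟩ = ⟨pq⁻¹, (δq)q⁻¹⟩`. -/
theorem pullCovector_eq {n : ℕ} (P : Euc n → CotangentBundle E G) (u : Euc n) :
    pullCovector P u = (momentum (P u)).comp (rlog (fun w => (P w).1) u) := by
  ext v
  refine (fiberForm_apply (P u) _).trans rfl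

theorem momentum_smul (g : G) (p : CotangentBundle E G) :
    momentum (g • p) = (momentum p).comp (Ad g⁻¹) := by
  ext Z
  change fiberForm p (tderiv (fun x : G => g⁻¹ * x) (g * p.1)
      (tderiv (fun x : G => x * (g * p.1)) 1 Z)) =
    fiberForm p (tderiv (fun x : G => x * p.1) 1 (tderiv (fun x : G => g⁻¹ * x * g⁻¹⁻¹) 1 Z))
  rw [tderiv_chain contMDiff_mul_left contMDiff_mul_right _ _ (one_mul _),
    tderiv_chain contMDiff_mul_right (contMDiff_conj _) _ _ (by simp)]
  simp only [mul_assoc, inv_inv]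

theorem momentum_rightTranslate (p : CotangentBundle E G) (h : G) :
    momentum (rightTranslate p h) = momentum p := momentLeft_rightTranslate p h

/-- Moving the condition `ψ(p) = 0` to the identity by right instead of left translation
introduces an `Ad`. -/
theorem momentRight_eq_zero_iff (H : Subgroup G) (p : CotangentBundle E G) :
    momentRight H p = 0 ↔ ∀ Z : E, Z ∈ subgroupLieAlgebra E H → momentum p (Ad p.1 Z) = 0 := by
  have key : ∀ Z : E, fiberForm p (tderiv (fun x : G => p.1 * x) 1 Z) =
      momentum p (Ad p.1 Z) := fun Z => by
    rw [fiberForm_apply, tderiv_chain contMDiff_mul_right contMDiff_mul_left _ _ (mul_one _)]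
    rfl
  constructor
  · intro h Z hZ
    rw [← key]
    exact neg_eq_zero.1 (congrArg (fun l : Module.Dual ℝ (subgroupLieAlgebra E H) => l ⟨Z, hZ⟩) h)
  · intro h
    ext ⟨Z, hZ⟩
    exact neg_eq_zero.2 ((key Z).trans (h Z hZ))

end Momentum

/-! ### Smooth families in a subgroup are tangent to its Lie algebra -/

section OneParameter
variable {E : Type*} [NormedAddCommGroup E] [NormedSpace ℝ E]
  {V : Type*} [NormedAddCommGroup V] [NormedSpace ℝ V]
  {G : Type*} [TopologicalSpace G] [ChartedSpace E G] [Group G] [LieGroup 𝓘(ℝ, E) ∞ G]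

theorem velocity_eq_rlog {c : ℝ → G} (h : c 0 = 1) : velocity c = rlog (E := E) c 0 1 := by
  rw [rlog_of_eq_one h]
  rfl

variable (E) in
/-- The velocities at the identity of the smooth curves in `G` that stay in the subgroup `H`. -/
noncomputable def velocitySubmodule (H : Subgroup G) : Submodule ℝ E where
  carrier := {Z | ∃ c : ℝ → G, SmoothMap 𝓘(ℝ, E) c ∧ c 0 = 1 ∧ (∀ t, c t ∈ H) ∧
    rlog (E := E) c 0 1 = Z}
  zero_mem' := ⟨fun _ => 1, contMDiff_const, rfl, fun _ => H.one_mem, by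
    rw [rlog_const, zero_apply]⟩
  add_mem' := by
    rintro _ _ ⟨c, hc, c0, cH, rfl⟩ ⟨d, hd, d0, dH, rfl⟩
    refine ⟨fun t => c t * d t, hc.mul hd, by simp only [c0, d0, mul_one],
      fun t => H.mul_mem (cH t) (dH t), ?_⟩
    rw [rlog_mul (hc.mdiffAt 0) (hd.mdiffAt 0), c0, Ad_one]
  smul_mem' := by
    rintro a _ ⟨c, hc, c0, cH, rfl⟩
    have ha : ContDiff ℝ ∞ fun t : ℝ => a * t := by fun_prop
    refine ⟨fun t => c (a * t), hc.comp ha.contMDiff, by simp only [mul_zero, c0],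
      fun t => cH _, ?_⟩
    have hd : fderiv ℝ (fun t : ℝ => a * t) 0 1 = a • (1 : ℝ) := by
      rw [fderiv_const_mul differentiableAt_id]
      simp
    rw [rlog_comp_right (hc.mdiffAt _) (ha.differentiable (by simp) 0), mul_zero, hd, map_smul]

/-- After right translation by `p(u)⁻¹`, the restriction of `p` to a line through `u` is a curve in
`H` starting at the identity. -/
theorem rlog_mem_velocitySubmodule {H : Subgroup G} {p : V → G} (hp : SmoothMap 𝓘(ℝ, E) p)
    (hH : ∀ u, p u ∈ H) (u v : V) : rlog (E := E) p u v ∈ velocitySubmodule E H := by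
  have hl : ContDiff ℝ ∞ fun t : ℝ => u + t • v := by fun_prop
  have hd : fderiv ℝ (fun t : ℝ => u + t • v) 0 1 = v := by
    rw [fderiv_const_add, fderiv_smul_const differentiableAt_id]
    simp
  have hc : SmoothMap 𝓘(ℝ, E) fun t : ℝ => p (u + t • v) := hp.comp hl.contMDiff
  refine ⟨fun t => p (u + t • v) * (p u)⁻¹, hc.mul contMDiff_const, by simp,
    fun t => H.mul_mem (hH _) (H.inv_mem (hH _)), ?_⟩
  rw [rlog_mul (hc.mdiffAt 0) mdifferentiableAt_const, rlog_const, zero_apply, map_zero, add_zero,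
    rlog_comp_right (hp.mdiffAt _) (hl.differentiable (by simp) 0), hd]
  simp

/-- A product of curves in `H`, each running in its own coordinate `φ i`. -/
theorem rlog_list_prod {H : Subgroup G} {ι : Type*} (c : ι → ℝ → G)
    (hc : ∀ i, SmoothMap 𝓘(ℝ, E) (c i)) (c0 : ∀ i, c i 0 = 1) (cH : ∀ i t, c i t ∈ H)
    (φ : ι → V →L[ℝ] ℝ) (l : List ι) :
    SmoothMap 𝓘(ℝ, E) (fun x => (l.map fun i => c i (φ i x)).prod) ∧
      (l.map fun i => c i (φ i 0)).prod = 1 ∧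
      (∀ x, (l.map fun i => c i (φ i x)).prod ∈ H) ∧
      ∀ v, rlog (E := E) (fun x => (l.map fun i => c i (φ i x)).prod) 0 v =
        (l.map fun i => φ i v • rlog (E := E) (c i) 0 1).sum := by
  induction l with
  | nil =>
    refine ⟨contMDiff_const, rfl, fun _ => H.one_mem, fun v => ?_⟩
    simp only [List.map_nil, List.prod_nil, List.sum_nil, rlog_const, zero_apply]
  | cons i l ih =>
    obtain ⟨h1, h2, h3, h4⟩ := ih
    have hi : SmoothMap 𝓘(ℝ, E) fun x => c i (φ i x) := (hc i).comp (φ i).contDiff.contMDiff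
    simp only [List.map_cons, List.prod_cons, List.sum_cons]
    refine ⟨hi.mul h1, by rw [h2, map_zero, c0, mul_one], fun x => H.mul_mem (cH _ _) (h3 x),
      fun v => ?_⟩
    rw [rlog_mul (hi.mdiffAt 0) (h1.mdiffAt 0), h4, map_zero, c0, Ad_one,
      rlog_comp_right ((hc i).mdiffAt _) (φ i).differentiableAt, ContinuousLinearMap.fderiv,
      map_zero, ← map_smul, smul_eq_mul, mul_one]

/-- The velocities of curves in `H` are realised simultaneously by one smooth map into `H`: the
product of curves with velocities in a basis, each running in its own coordinate. -/
theorem exists_chart_velocitySubmodule [FiniteDimensional ℝ E] (H : Subgroup G) :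
    ∃ F : velocitySubmodule E H → G, SmoothMap 𝓘(ℝ, E) F ∧ F 0 = 1 ∧ (∀ x, F x ∈ H) ∧
      ∀ v, rlog (E := E) F 0 v = v := by
  let b := Module.finBasis ℝ (velocitySubmodule E H)
  choose c hc c0 cH hcb using fun i => (b i).2
  obtain ⟨h1, h2, h3, h4⟩ := rlog_list_prod c hc c0 cH
    (fun i => LinearMap.toContinuousLinearMap (b.coord i)) (List.finRange _)
  refine ⟨_, h1, h2, h3, fun v => ?_⟩
  rw [h4, ← Fin.sum_univ_def]
  simp only [hcb]
  conv_rhs => rw [← b.sum_repr v]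
  rw [Submodule.coe_sum]
  rfl

/-- Bootstrapping: a solution of an autonomous differential equation with smooth right hand side
is smooth. -/
theorem contDiffOn_of_hasDerivAt {V : Type*} [NormedAddCommGroup V] [NormedSpace ℝ V]
    {ξ : V → V} {α : ℝ → V} {U : Set V} {I : Set ℝ} (hI : IsOpen I) (hξ : ContDiffOn ℝ ∞ ξ U)
    (hα : ∀ t ∈ I, HasDerivAt α (ξ (α t)) t) (hU : ∀ t ∈ I, α t ∈ U) : ContDiffOn ℝ ∞ α I := by
  rw [contDiffOn_infty]
  intro n
  induction n with
  | zero =>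
    rw [Nat.cast_zero, contDiffOn_zero]
    exact fun t ht => (hα t ht).continuousAt.continuousWithinAt
  | succ n ih =>
    rw [Nat.cast_succ, contDiffOn_succ_iff_deriv_of_isOpen hI]
    refine ⟨fun t ht => (hα t ht).differentiableAt.differentiableWithinAt, by simp, ?_⟩
    refine ((hξ.of_le (by exact_mod_cast le_top)).comp ih hU).congr fun t ht => (hα t ht).deriv

/-- A vector tangent to `H` is the velocity of a local one-parameter subgroup in `H`, in the form
of an integral curve of the corresponding left-invariant vector field. -/
theorem exists_local_curve [FiniteDimensional ℝ E] (H : Subgroup G) {Z : E}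
    (hZ : Z ∈ velocitySubmodule E H) :
    ∃ ε > 0, ∃ γ : ℝ → G, γ 0 = 1 ∧ (∀ t, γ t ∈ H) ∧
      ContMDiffOn 𝓘(ℝ, ℝ) 𝓘(ℝ, E) ∞ γ (Set.Ioo (-ε) ε) ∧
      ∀ t ∈ Set.Ioo (-ε) ε, rlog (E := E) γ t 1 = Ad (γ t) Z := by
  obtain ⟨F, hF, F0, FH, hF0⟩ := exists_chart_velocitySubmodule (E := E) H
  let S := velocitySubmodule E H
  obtain ⟨π, hπ⟩ := LinearMap.exists_leftInverse_of_injective S.subtype (by simp)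
  let B : S → S →L[ℝ] S := fun x => (LinearMap.toContinuousLinearMap π).comp (rlog F x)
  have hπ' : ∀ s : S, π s = s := fun s => congrArg (fun l : S →ₗ[ℝ] S => l s) hπ
  have hB : ContDiff ℝ ∞ B := contDiff_const.clm_comp (contDiff_rlog hF)
  have hBv : ∀ x v, (B x v : E) = rlog F x v := fun x v =>
    congrArg Subtype.val (hπ' ⟨_, rlog_mem_velocitySubmodule hF FH x v⟩)
  have hB0 : B 0 = ContinuousLinearMap.id ℝ S := by
    ext v
    rw [hBv, hF0]
    rfl
  let U : Set S := B ⁻¹' (Set.range ((↑) : (S ≃L[ℝ] S) → S →L[ℝ] S))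
  have hU : IsOpen U := ContinuousLinearEquiv.isOpen.preimage hB.continuous
  have h0U : (0 : S) ∈ U := ⟨ContinuousLinearEquiv.refl ℝ S, hB0.symm⟩
  -- the vector field whose integral curves `α` make `F(α)⁻¹` a one-parameter subgroup: the sign
  -- is that of the logarithmic derivative of an inverse
  let ξ : S → S := fun x => (B x).inverse (-⟨Z, hZ⟩)
  have hξ : ∀ x ∈ U, ContDiffAt ℝ ∞ ξ x := by
    rintro x ⟨e, he⟩
    have h1 : ContDiffAt ℝ ∞ (ContinuousLinearMap.inverse (R := ℝ) (M := S) (M₂ := S)) (B x) :=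
      he ▸ contDiffAt_map_inverse e
    exact (h1.comp x hB.contDiffAt).clm_apply contDiffAt_const
  have hBξ : ∀ x ∈ U, rlog F x (ξ x) = -Z := by
    rintro x ⟨e, he⟩
    rw [← hBv]
    have : B x (ξ x) = -⟨Z, hZ⟩ := by
      change B x ((B x).inverse _) = _
      rw [← he, ContinuousLinearMap.inverse_equiv]
      exact e.apply_symm_apply _
    rw [this]
    rfl
  obtain ⟨α, hα0, ε₁, hε₁, hα⟩ :=
    ((hξ 0 h0U).of_le (m := 1) (by
      exact_mod_cast le_top)).exists_forall_mem_closedBall_exists_eq_forall_mem_Ioo_hasDerivAt₀ 0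
  simp only [zero_sub, zero_add] at hα
  have hαc : ContinuousAt α 0 := (hα 0 ⟨neg_lt_zero.2 hε₁, hε₁⟩).continuousAt
  obtain ⟨ε₂, hε₂, hball⟩ := Metric.mem_nhds_iff.1
    (hαc.preimage_mem_nhds (hα0.symm ▸ hU.mem_nhds h0U))
  have hsub : ∀ t ∈ Set.Ioo (-(min ε₁ ε₂)) (min ε₁ ε₂), HasDerivAt α (ξ (α t)) t ∧ α t ∈ U := by
    rintro t ⟨ht1, ht2⟩
    have h1 := min_le_left ε₁ ε₂
    have h2 := min_le_right ε₁ ε₂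
    refine ⟨hα t ⟨by linarith, by linarith⟩, hball ?_⟩
    rw [Metric.mem_ball, Real.dist_eq, sub_zero, abs_lt]
    exact ⟨by linarith, by linarith⟩
  have hαs : ContDiffOn ℝ ∞ α (Set.Ioo (-(min ε₁ ε₂)) (min ε₁ ε₂)) :=
    contDiffOn_of_hasDerivAt isOpen_Ioo (fun x hx => (hξ x hx).contDiffWithinAt)
      (fun t ht => (hsub t ht).1) fun t ht => (hsub t ht).2
  refine ⟨min ε₁ ε₂, lt_min hε₁ hε₂, fun t => (F (α t))⁻¹, by simp only [hα0, F0, inv_one],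
    fun t => H.inv_mem (FH _), (hF.comp_contMDiffOn hαs.contMDiffOn).inv, fun t ht => ?_⟩
  obtain ⟨h1, h2⟩ := hsub t ht
  have h3 : MDifferentiableAt 𝓘(ℝ, ℝ) 𝓘(ℝ, E) (fun t => F (α t)) t :=
    (hF.mdiffAt (α t)).comp t h1.differentiableAt.mdifferentiableAt
  rw [rlog_inv h3,
    rlog_comp_right (hF.mdiffAt _) h1.differentiableAt, ← deriv, h1.deriv, hBξ _ h2, map_neg,
    neg_neg]

/-- The curves with left logarithmic derivative `Z` are the integral curves of the left-invariant
vector field of `Z`. -/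
theorem hasMFDerivAt_of_rlog {c : ℝ → G} {t : ℝ} {Z : E}
    (hc : MDifferentiableAt 𝓘(ℝ, ℝ) 𝓘(ℝ, E) c t) (h : rlog (E := E) c t 1 = Ad (c t) Z) :
    HasMFDerivAt 𝓘(ℝ, ℝ) 𝓘(ℝ, E) c t ((1 : ℝ →L[ℝ] ℝ).smulRight
      (mulInvariantVectorField (I := 𝓘(ℝ, E)) (G := G) Z (c t))) := by
  have h1 : vderiv (E := E) c t 1 = tderiv (fun x => c t * x) 1 Z := by
    rw [vderiv_eq_rlog, h, Ad, tderiv_chain contMDiff_mul_right (contMDiff_conj _) _ _ (by simp)]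
    simp only [inv_mul_cancel_right]
  have h2 : vderiv (E := E) c t = (1 : ℝ →L[ℝ] ℝ).smulRight (tderiv (fun x => c t * x) 1 Z) := by
    ext
    simpa using h1
  have h3 := hc.hasMFDerivAt
  exact (show HasMFDerivAt 𝓘(ℝ, ℝ) 𝓘(ℝ, E) c t (vderiv (E := E) c t) from h3).congr_mfderiv h2

theorem rlog_of_hasMFDerivAt {c : ℝ → G} {t : ℝ} {Z : E}
    (h : HasMFDerivAt 𝓘(ℝ, ℝ) 𝓘(ℝ, E) c t ((1 : ℝ →L[ℝ] ℝ).smulRight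
      (mulInvariantVectorField (I := 𝓘(ℝ, E)) (G := G) Z (c t)))) :
    rlog (E := E) c t 1 = Ad (c t) Z := by
  have h2 : vderiv (E := E) c t 1 = (tderiv (fun x => c t * x) 1 Z) := by
    have h3 : vderiv (E := E) c t = (1 : ℝ →L[ℝ] ℝ).smulRight (tderiv (fun x => c t * x) 1 Z) :=
      h.mfderiv
    rw [h3]
    simp
  rw [rlog_apply, h2, Ad, tderiv_chain contMDiff_mul_right contMDiff_mul_left _ _ (mul_one _)]

/-- The velocities of curves in `H` are those of one-parameter subgroups contained in `H`. No
closedness of `H` is needed: the local solution `F(α(t))⁻¹` lies in `H` because `F` does. -/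
theorem exists_oneParameter [FiniteDimensional ℝ E] (H : Subgroup G) {Z : E}
    (hZ : Z ∈ velocitySubmodule E H) :
    ∃ c : ℝ → G, SmoothMap 𝓘(ℝ, E) c ∧ (∀ s t, c (s + t) = c s * c t) ∧ velocity c = Z ∧
      ∀ t, c t ∈ H := by
  -- uniqueness of integral curves needs `G` to be Hausdorff, which a `T1` group is
  have : IsTopologicalGroup G := topologicalGroup_of_lieGroup 𝓘(ℝ, E) ∞
  have : T1Space G := ChartedSpace.t1Space E G
  have : CompleteSpace E := FiniteDimensional.complete ℝ E
  have : LieGroup 𝓘(ℝ, E) (minSmoothness ℝ 3) G :=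
    LieGroup.of_le (n := ∞) (by
      simp only [minSmoothness_of_isRCLikeNormedField]
      exact WithTop.coe_le_coe.2 (le_top (a := (3 : ℕ∞))))
  obtain ⟨ε, hε, γ, γ0, γH, hγ, hγZ⟩ := exists_local_curve H hZ
  have hv := (contMDiff_mulInvariantVectorField (I := 𝓘(ℝ, E)) (G := G) Z).of_le (m := 1) (by simp)
  have hγd : ∀ t ∈ Set.Ioo (-ε) ε, MDifferentiableAt 𝓘(ℝ, ℝ) 𝓘(ℝ, E) γ t := fun t ht =>
    (hγ.contMDiffAt (isOpen_Ioo.mem_nhds ht)).mdifferentiableAt (by simp)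
  have hγx : ∀ x : G, IsMIntegralCurveOn (I := 𝓘(ℝ, E)) (fun t => x * γ t)
      (mulInvariantVectorField Z) (Set.Ioo (-ε) ε) := fun x t ht => by
    refine (hasMFDerivAt_of_rlog ?_ ?_).hasMFDerivWithinAt
    · exact ((contMDiff_mul_left (a := x)).mdifferentiable (n := ∞) (by simp) _).comp t (hγd t ht)
    · rw [rlog_mul_left (hγd t ht), hγZ t ht, Ad_mul]
  obtain ⟨c, c0, hc⟩ := exists_isMIntegralCurve_of_isMIntegralCurveOn hv hε
    (fun x => ⟨fun t => x * γ t, by simp only [γ0, mul_one], hγx x⟩) 1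
  have hcγ : Set.EqOn c γ (Set.Ioo (-ε) ε) := by
    refine isMIntegralCurveOn_Ioo_eqOn_of_contMDiff_boundaryless (t₀ := 0)
      ⟨neg_lt_zero.2 hε, hε⟩ hv (hc.isMIntegralCurveOn _) ?_ (c0.trans γ0.symm)
    simpa only [one_mul] using hγx 1
  have hadd : ∀ s t, c (s + t) = c s * c t := by
    intro s
    refine congrFun (isMIntegralCurve_Ioo_eq_of_contMDiff_boundaryless (t₀ := 0) hv
      (γ := fun t => c (s + t)) ?_ ?_ ?_)
    · simpa only [Function.comp_def, add_comm] using hc.comp_add s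
    · intro t
      have ht := hc t
      refine hasMFDerivAt_of_rlog (c := fun t => c s * c t) ?_ ?_
      · exact ((contMDiff_mul_left (a := c s)).mdifferentiable (n := ∞) (by simp) _).comp t
          ht.mdifferentiableAt
      · rw [rlog_mul_left ht.mdifferentiableAt, rlog_of_hasMFDerivAt ht, Ad_mul]
    · simp only [add_zero, c0, mul_one]
  have hI : Set.Ioo (-ε) ε ∈ 𝓝 (0 : ℝ) := Ioo_mem_nhds (neg_lt_zero.2 hε) hε
  have hcs : SmoothMap 𝓘(ℝ, E) c := by
    intro s
    have h1 : ContMDiffAt 𝓘(ℝ, ℝ) 𝓘(ℝ, E) ∞ (fun t => γ (t - s)) s := by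
      refine ContMDiffAt.comp s (g := γ) (f := fun t => t - s) ?_
        (contDiff_id.sub contDiff_const).contMDiff.contMDiffAt
      rw [sub_self]
      exact hγ.contMDiffAt hI
    refine (contMDiffAt_const (c := c s)).mul h1 |>.congr_of_eventuallyEq ?_
    have h2 : Filter.Tendsto (fun t => t - s) (𝓝 s) (𝓝 0) :=
      (continuous_sub_right s).tendsto' _ _ (sub_self s)
    filter_upwards [h2.eventually hI] with t ht
    simp only [Pi.mul_apply]
    rw [← hcγ ht, ← hadd, add_sub_cancel]
  refine ⟨c, hcs, hadd, ?_, fun t => ?_⟩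
  · rw [velocity_eq_rlog c0, rlog_of_hasMFDerivAt (hc 0), c0, Ad_one]
  -- `c(t)` is a power of `c(t/n)`, which lies in `H` for large `n`
  · have hpow : ∀ (n : ℕ) (s : ℝ), c (n * s) = c s ^ n := by
      intro n s
      induction n with
      | zero => simp [c0]
      | succ n ih => rw [Nat.cast_succ, add_mul, one_mul, hadd, ih, pow_succ]
    have h2 : Filter.Tendsto (fun n : ℕ => t / n) Filter.atTop (𝓝 0) :=
      tendsto_const_div_atTop_nhds_zero_nat t
    obtain ⟨n, hn, hn1⟩ := ((h2.eventually hI).and (Filter.eventually_ge_atTop 1)).exists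
    have hn0 : (n : ℝ) ≠ 0 := by exact_mod_cast (by omega : n ≠ 0)
    rw [← mul_div_cancel₀ t hn0, hpow, hcγ hn]
    exact H.pow_mem (γH _) n

/-- The logarithmic derivative of a smooth map with values in `H` takes its values in `𝔥`, for any
subgroup `H`. -/
theorem rlog_mem_subgroupLieAlgebra [FiniteDimensional ℝ E] {H : Subgroup G} {p : V → G}
    (hp : SmoothMap 𝓘(ℝ, E) p) (hH : ∀ u, p u ∈ H) (u v : V) :
    rlog (E := E) p u v ∈ subgroupLieAlgebra E H :=
  Submodule.subset_span (exists_oneParameter H (rlog_mem_velocitySubmodule hp hH u v))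

end OneParameter

/-! ### The Lie algebra of a dense subgroup is invariant -/

section Invariance
variable {E : Type*} [NormedAddCommGroup E] [NormedSpace ℝ E]
  {G : Type*} [TopologicalSpace G] [ChartedSpace E G] [Group G] [LieGroup 𝓘(ℝ, E) ∞ G]

theorem oneParameter_zero {c : ℝ → G} (hadd : ∀ s t, c (s + t) = c s * c t) : c 0 = 1 := by
  have := hadd 0 0
  rwa [add_zero, left_eq_mul] at this

/-- Conjugation by an element of `H` permutes the one-parameter subgroups contained in `H`. -/
theorem Ad_mem_of_mem {H : Subgroup G} {h : G} (hh : h ∈ H) {Z : E}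
    (hZ : Z ∈ subgroupLieAlgebra E H) : Ad h Z ∈ subgroupLieAlgebra E H := by
  let S : Submodule ℝ E := subgroupLieAlgebra E H
  have hle : S ≤ S.comap (Ad h : E →L[ℝ] E).toLinearMap := by
    refine Submodule.span_le.2 ?_
    rintro _ ⟨c, hc, hadd, rfl, hcH⟩
    have c0 := oneParameter_zero hadd
    refine Submodule.subset_span ⟨fun t => h * c t * h⁻¹,
      (contMDiff_conj h).comp hc, fun s t => ?_, ?_, fun t =>
      H.mul_mem (H.mul_mem hh (hcH t)) (H.inv_mem hh)⟩
    · simp only [hadd, mul_assoc, inv_mul_cancel_left]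
    · have h1 : SmoothMap 𝓘(ℝ, E) fun t => h * c t := contMDiff_mul_left.comp hc
      rw [velocity_eq_rlog c0, velocity_eq_rlog (by simp [c0]),
        rlog_mul (h1.mdiffAt 0) mdifferentiableAt_const, rlog_const, zero_apply, map_zero, add_zero,
        rlog_mul_left (hc.mdiffAt 0)]
      rfl
  exact hle hZ

/-- The Lie algebra of a dense subgroup is invariant under the adjoint action of the whole group,
being a closed subspace. -/
theorem Ad_mem_subgroupLieAlgebra [FiniteDimensional ℝ E] {H : Subgroup G}
    (hH : Dense (H : Set G)) (g : G) {Z : E} (hZ : Z ∈ subgroupLieAlgebra E H) :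
    Ad g Z ∈ subgroupLieAlgebra E H := by
  let S : Submodule ℝ E := subgroupLieAlgebra E H
  have hS : IsClosed (S : Set E) := S.closed_of_finiteDimensional
  have h1 : IsClosed {g : G | Ad g Z ∈ (S : Set E)} :=
    hS.preimage (continuous_Ad.clm_apply continuous_const)
  have h2 : closure (H : Set G) ⊆ {g : G | Ad g Z ∈ (S : Set E)} :=
    closure_minimal (fun h hh => Ad_mem_of_mem hh hZ) h1
  exact h2 (hH g)

/-- The linear form `μ` on the Lie algebra of `G` vanishes on that of `H`. -/
def Annihilates (H : Subgroup G) (μ : E →L[ℝ] ℝ) : Prop :=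
  ∀ Z : E, Z ∈ subgroupLieAlgebra E H → μ Z = 0

/-- For dense `H`, the zero level is the product of `G` and the annihilator of `𝔥` in the right
trivialisation. -/
theorem momentRight_eq_zero_iff_annihilates [FiniteDimensional ℝ E] {H : Subgroup G}
    (hH : Dense (H : Set G)) (p : CotangentBundle E G) :
    momentRight H p = 0 ↔ Annihilates H (momentum p) := by
  rw [momentRight_eq_zero_iff]
  refine ⟨fun h Z hZ => ?_, fun h Z hZ => h _ (Ad_mem_subgroupLieAlgebra hH _ hZ)⟩
  rw [← Ad_Ad_inv p.1 Z]
  exact h _ (Ad_mem_subgroupLieAlgebra hH _ hZ)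

end Invariance

/-! ### Differential forms of degree one -/

section Forms
variable {X : Type*} [DiffeologicalSpace X]

theorem oneForm_ext {V : Type*} [NormedAddCommGroup V] [NormedSpace ℝ V]
    {a b : V [⋀^Fin 1]→L[ℝ] ℝ} (h : ∀ v, a ![v] = b ![v]) : a = b := by
  ext v
  rw [show v = ![v 0] from by ext i; fin_cases i; rfl]
  exact h _

theorem DForm.toFun_const (α : DForm X 1) {n : ℕ} (x : X) (u v : Euc n) :
    α.toFun (fun _ : Euc n => x) isPlot_const u ![v] = 0 := by
  have h := α.compat (fun _ : Euc n => x) isPlot_const (fun _ : Euc n => (0 : Euc n))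
    contDiff_const u
  have h' := congrArg (fun b : (Euc n) [⋀^Fin 1]→L[ℝ] ℝ => b ![v]) h
  refine Eq.trans h' ?_
  simp only [ContinuousAlternatingMap.compContinuousLinearMap_apply]
  exact ContinuousAlternatingMap.map_coord_zero _ 0 (by simp)

/-- A form on a quotient is determined by its pull-back. -/
theorem DForm.pullback_mk_injective {k : ℕ} {s : Setoid X} {α β : DForm (Quotient s) k}
    (h : α.pullback (Quotient.mk s) (dSmooth_mk s) = β.pullback (Quotient.mk s) (dSmooth_mk s)) :
    α = β := by
  ext1
  funext n p hp u
  obtain ⟨q, hq, hqp⟩ := hp u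
  rw [← α.toFun_germ (dSmooth_mk s n q hq) hp hqp, ← β.toFun_germ (dSmooth_mk s n q hq) hp hqp]
  exact congrArg (fun γ : DForm X k => γ.toFun q hq u) h

end Forms

/-! ### Continuity along plots -/

section Continuity
variable {E : Type*} [NormedAddCommGroup E] [NormedSpace ℝ E] [FiniteDimensional ℝ E]
  {M : Type*} [TopologicalSpace M] [ChartedSpace E M] [IsManifold 𝓘(ℝ, E) ∞ M]

/-- A map on a manifold is continuous if it is continuous along all smooth maps `ℝⁿ → M`. -/
theorem continuous_of_forall_smoothMap {Y : Type*} [TopologicalSpace Y] {f : M → Y}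
    (h : ∀ (n : ℕ) (p : Euc n → M), SmoothMap 𝓘(ℝ, E) p → Continuous fun u => f (p u)) :
    Continuous f := by
  rw [continuous_iff_continuousAt]
  intro x
  let e := extChartAt 𝓘(ℝ, E) x
  obtain ⟨k, k1, k2, k3⟩ := exists_confine (u := e.target) (x := e x)
    (extChartAt_target_mem_nhds x)
  let L : Euc (Module.finrank ℝ E) ≃L[ℝ] E := toEuclidean.symm
  have hk : ContMDiff 𝓘(ℝ, E) 𝓘(ℝ, E) ∞ (fun y => e.symm (k y)) := by
    rw [← contMDiffOn_univ]
    exact (contMDiffOn_extChartAt_symm x).comp k1.contMDiff.contMDiffOn fun y _ => k2 y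
  have hc := (h _ _ (hk.comp L.contDiff.contMDiff)).continuousAt (x := L.symm (e x))
  have he : ContinuousAt (fun y => L.symm (e y)) x :=
    L.symm.continuous.continuousAt.comp (continuousAt_extChartAt x)
  refine (ContinuousAt.comp (f := fun y => L.symm (e y)) hc he).congr ?_
  filter_upwards [extChartAt_source_mem_nhds (I := 𝓘(ℝ, E)) x,
    (continuousAt_extChartAt x).eventually k3] with y hy hky
  have h1 : e.symm (k (L (L.symm (e y)))) = y := by
    rw [L.apply_symm_apply, hky]
    exact e.left_inv hy
  exact congrArg f h1

end Continuity

/-! ### One-forms on the coset space of a dense subgroup -/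

section FormsOnGroup
variable {E : Type*} [NormedAddCommGroup E] [NormedSpace ℝ E]
  {G : Type*} [TopologicalSpace G] [ChartedSpace E G] [Group G] [LieGroup 𝓘(ℝ, E) ∞ G]
  [DiffeologicalSpace G] [IsManifoldDiffeology E G]

theorem smoothMap_of_isPlot {n : ℕ} {p : Euc n → G} (hp : IsPlot p) : SmoothMap 𝓘(ℝ, E) p :=
  (IsManifoldDiffeology.isPlot_iff (E := E)).1 hp

/-- The right-invariant `1`-form on `G` with value `ν` at the identity. -/
noncomputable def rightForm (ν : E →L[ℝ] ℝ) : DForm G 1 where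
  toFun q _ u := oneForm (ν.comp (rlog q u))
  smooth _ hq := (ContinuousAlternatingMap.ofSubsingletonLIE (𝕜 := ℝ) (E := Euc _) (F := ℝ)
    (0 : Fin 1)).toContinuousLinearEquiv.contDiff.comp
      (contDiff_const.clm_comp (contDiff_rlog (smoothMap_of_isPlot hq)))
  compat q hq f hf y := by
    refine oneForm_ext fun v => ?_
    exact congrArg ν (rlog_comp_right ((smoothMap_of_isPlot hq).mdiffAt _)
      (hf.differentiable (by simp) y) v)

variable [FiniteDimensional ℝ E]

theorem mk_eq_mk_iff {H : Subgroup G} {a b : G} :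
    (Quotient.mk (QuotientGroup.leftRel H) a = Quotient.mk (QuotientGroup.leftRel H) b) ↔
      a⁻¹ * b ∈ H := by
  rw [Quotient.eq]
  exact QuotientGroup.leftRel_apply

/-- Plots of `G` that agree modulo `H` differ by a plot with values in `H`, whose contribution to
the logarithmic derivative `ν` does not see. -/
theorem rightForm_basic {H : Subgroup G} (hH : Dense (H : Set G)) {ν : E →L[ℝ] ℝ}
    (hν : Annihilates H ν) {n : ℕ} {p q : Euc n → G} (hp : IsPlot p) (hq : IsPlot q)
    (h : ∀ u, (p u)⁻¹ * q u ∈ H) (u : Euc n) : ν.comp (rlog p u) = ν.comp (rlog q u) := by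
  have hp' := smoothMap_of_isPlot (E := E) hp
  have hq' := smoothMap_of_isPlot (E := E) hq
  have hr : SmoothMap 𝓘(ℝ, E) fun u => (p u)⁻¹ * q u := hp'.inv.mul hq'
  ext v
  have h1 := rlog_mul (hp'.mdiffAt u) (hr.mdiffAt u) v
  simp only [mul_inv_cancel_left] at h1
  rw [ContinuousLinearMap.comp_apply, ContinuousLinearMap.comp_apply]
  rw [h1, map_add, hν _ (Ad_mem_subgroupLieAlgebra hH _ (rlog_mem_subgroupLieAlgebra hr h u v)),
    add_zero]

theorem rightForm_descends {H : Subgroup G} (hH : Dense (H : Set G)) {ν : E →L[ℝ] ℝ}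
    (hν : Annihilates H ν) (n : ℕ) (p q : Euc n → G) (hp : IsPlot p) (hq : IsPlot q)
    (h : ∀ u, Quotient.mk (QuotientGroup.leftRel H) (p u) =
      Quotient.mk (QuotientGroup.leftRel H) (q u)) :
    (rightForm ν).toFun p hp = (rightForm ν).toFun q hq := by
  funext u
  refine oneForm_ext fun v => ?_
  exact congrArg (fun l : Euc n →L[ℝ] ℝ => l v)
    (rightForm_basic hH hν hp hq (fun u => mk_eq_mk_iff.1 (h u)) u)

/-- The `1`-form on `G/H` whose pull-back to `G` is the right-invariant form with value `ν` at the
identity, for `ν` vanishing on the Lie algebra of the dense subgroup `H`. -/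
noncomputable def cosetForm {H : Subgroup G} (hH : Dense (H : Set G)) (ν : E →L[ℝ] ℝ)
    (hν : Annihilates H ν) : DForm (G ⧸ H) 1 :=
  (rightForm ν).descend (s := QuotientGroup.leftRel H) (rightForm_descends hH hν)

theorem dSmooth_coset (H : Subgroup G) : DSmooth (QuotientGroup.mk : G → G ⧸ H) :=
  dSmooth_mk (QuotientGroup.leftRel H)

theorem cosetForm_apply {H : Subgroup G} (hH : Dense (H : Set G)) (ν : E →L[ℝ] ℝ)
    (hν : Annihilates H ν) {n : ℕ} {p : Euc n → G ⧸ H} (hp : IsPlot p) (q : Euc n → G)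
    (hq : IsPlot q) (u : Euc n) (hqp : (fun w => (q w : G ⧸ H)) =ᶠ[𝓝 u] p) (v : Euc n) :
    (cosetForm hH ν hν).toFun p hp u ![v] = ν (rlog q u v) := by
  rw [← (cosetForm hH ν hν).toFun_germ (dSmooth_coset H n q hq) hp hqp]
  exact congrArg (fun γ : DForm G 1 => γ.toFun q hq u ![v])
    (DForm.pullback_descend (rightForm ν) (rightForm_descends hH hν))

/-- The value at `g` of a `1`-form on `G`, carried to the identity by right translation. -/
noncomputable def rightValue (a : DForm G 1) (g : G) : E →L[ℝ] ℝ :=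
  (show E →L[ℝ] ℝ from a.covectorAt (E := E) g).comp (tderiv (fun x => x * g) 1)

theorem toFun_eq_rightValue (a : DForm G 1) {n : ℕ} (q : Euc n → G) (hq : IsPlot q)
    (u v : Euc n) : a.toFun q hq u ![v] = rightValue (E := E) a (q u) (rlog q u v) := by
  rw [rightValue, ContinuousLinearMap.comp_apply, ← vderiv_eq_rlog]
  exact a.covectorAt_spec (E := E) q hq u v

/-- There is a smooth map `c : ℝᵈ → G` centred at the identity whose derivative there is an
isomorphism. -/
theorem exists_centered_plot : ∃ (d : ℕ) (L : Euc d ≃L[ℝ] E) (c : Euc d → G),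
    SmoothMap 𝓘(ℝ, E) c ∧ c 0 = 1 ∧ ∀ v, rlog c 0 v = L v := by
  obtain ⟨d, L, c, hc, c0, hL, -⟩ := exists_local_plot (E := E) (1 : G)
  refine ⟨d, L, c, hc, c0, fun v => ?_⟩
  rw [rlog_of_eq_one c0]
  exact congrArg (fun l : Euc d →L[ℝ] E => l v) hL.mfderiv

/-- The covectors of a diffeological `1`-form on `G` depend continuously on the point. -/
theorem continuous_rightValue (a : DForm G 1) : Continuous (rightValue (E := E) a) := by
  obtain ⟨d, L, c, hc, c0, hL⟩ := exists_centered_plot (E := E) (G := G)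
  refine continuous_of_forall_smoothMap (E := E) fun n r hr => ?_
  suffices h : ContDiff ℝ ∞ fun u => rightValue (E := E) a (r u) from h.continuous
  rw [contDiff_clm_apply_iff]
  intro e
  -- the values of `a` on the plot `(u, w) ↦ c(w) r(u)` in the directions of `w`
  let T : Euc (n + d) ≃L[ℝ] Euc n × Euc d := ContinuousLinearEquiv.ofFinrankEq (by simp)
  have hT1 : ContDiff ℝ ∞ (fun z => (T z).1) := contDiff_fst.comp T.contDiff
  have hT2 : ContDiff ℝ ∞ (fun z => (T z).2) := contDiff_snd.comp T.contDiff
  have h1 : SmoothMap 𝓘(ℝ, E) fun z => c (T z).2 := hc.comp hT2.contMDiff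
  have h2 : SmoothMap 𝓘(ℝ, E) fun z => r (T z).1 := hr.comp hT1.contMDiff
  have hs : IsPlot fun z => c (T z).2 * r (T z).1 :=
    (IsManifoldDiffeology.isPlot_iff (E := E)).2 (h1.mul h2)
  have hd1 : ∀ z w, fderiv ℝ (fun z => (T z).1) z w = (T w).1 := fun z w => by
    let l : Euc (n + d) →L[ℝ] _ := (ContinuousLinearMap.fst ℝ (Euc n) (Euc d)).comp
      (T : Euc (n + d) →L[ℝ] Euc n × Euc d)
    exact congrArg (fun m : Euc (n + d) →L[ℝ] _ => m w) (l.hasFDerivAt (x := z)).fderiv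
  have hd2 : ∀ z w, fderiv ℝ (fun z => (T z).2) z w = (T w).2 := fun z w => by
    let l : Euc (n + d) →L[ℝ] _ := (ContinuousLinearMap.snd ℝ (Euc n) (Euc d)).comp
      (T : Euc (n + d) →L[ℝ] Euc n × Euc d)
    exact congrArg (fun m : Euc (n + d) →L[ℝ] _ => m w) (l.hasFDerivAt (x := z)).fderiv
  have key : ∀ u, rightValue (E := E) a (r u) e =
      a.toFun _ hs (T.symm (u, 0)) ![T.symm (0, L.symm e)] := fun u => by
    rw [toFun_eq_rightValue (E := E), rlog_mul (h1.mdiffAt _) (h2.mdiffAt _),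
      rlog_comp_right (hc.mdiffAt _) (hT2.differentiable (by simp) _),
      rlog_comp_right (hr.mdiffAt _) (hT1.differentiable (by simp) _), hd1, hd2]
    simp only [T.apply_symm_apply, c0, one_mul, map_zero, add_zero, hL, L.apply_symm_apply]
  simp only [key]
  have hsm := (a.smooth _ hs).comp (T.symm.contDiff.comp
    (contDiff_id.prodMk (contDiff_const (c := (0 : Euc d)))))
  exact (ContinuousAlternatingMap.apply ℝ (Euc (n + d)) ℝ
    ![T.symm (0, L.symm e)]).contDiff.comp hsm

/-- The pull-back to `G` of a `1`-form on `G/H` is right-invariant under `H`, hence under `G` by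
density. -/
theorem rightValue_eq {H : Subgroup G} (hH : Dense (H : Set G)) (α : DForm (G ⧸ H) 1) (g : G) :
    rightValue (E := E) (α.pullback QuotientGroup.mk (dSmooth_coset H)) g =
      rightValue (α.pullback QuotientGroup.mk (dSmooth_coset H)) 1 := by
  obtain ⟨d, L, c, hc, c0, hL⟩ := exists_centered_plot (E := E) (G := G)
  have h1 : ∀ g : G, IsPlot fun w => c w * g := fun g =>
    (IsManifoldDiffeology.isPlot_iff (E := E)).2 (hc.mul contMDiff_const)
  have h2 : ∀ (g : G) (v : Euc d), rlog (E := E) (fun w => c w * g) 0 v = L v := fun g v => by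
    rw [rlog_mul_right (hc.mdiffAt 0), hL]
  -- for `h ∈ H`, the plots `c h` and `c` have the same projection to `G/H`
  have h3 : ∀ h ∈ H, rightValue (E := E) (α.pullback QuotientGroup.mk (dSmooth_coset H)) h =
      rightValue (α.pullback QuotientGroup.mk (dSmooth_coset H)) 1 := fun h hh => by
    ext e
    have e1 : ∀ g : G, rightValue (E := E) (α.pullback QuotientGroup.mk (dSmooth_coset H)) g e =
        (α.pullback QuotientGroup.mk (dSmooth_coset H)).toFun _ (h1 g) 0 ![L.symm e] := fun g => by
      rw [toFun_eq_rightValue (E := E), h2, c0, one_mul, L.apply_symm_apply]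
    rw [e1, e1]
    refine congrArg (fun b : Euc d [⋀^Fin 1]→L[ℝ] ℝ => b ![L.symm e])
      (congrFun (α.toFun_congr (funext fun w => ?_) _ _) 0)
    refine QuotientGroup.eq.2 ?_
    simpa using H.inv_mem hh
  have h4 := Continuous.ext_on hH (continuous_rightValue (E := E)
    (α.pullback QuotientGroup.mk (dSmooth_coset H))) continuous_const h3
  exact congrFun h4 g

/-- The value at the identity of the pull-back to `G` of a `1`-form on `G/H`. It determines the
form, by `cosetForm_formMomentum`. -/
noncomputable def formMomentum {H : Subgroup G} (α : DForm (G ⧸ H) 1) : E →L[ℝ] ℝ :=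
  rightValue (α.pullback QuotientGroup.mk (dSmooth_coset H)) 1

theorem toFun_coset {H : Subgroup G} (hH : Dense (H : Set G)) (α : DForm (G ⧸ H) 1) {n : ℕ}
    (q : Euc n → G) (hq : IsPlot q) (u v : Euc n) :
    α.toFun (fun w => (q w : G ⧸ H)) (dSmooth_coset H n q hq) u ![v] =
      formMomentum (E := E) α (rlog q u v) := by
  rw [formMomentum, ← rightValue_eq hH α (q u), ← toFun_eq_rightValue (E := E) _ q hq]
  rfl

theorem annihilates_formMomentum {H : Subgroup G} (hH : Dense (H : Set G))
    (α : DForm (G ⧸ H) 1) :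
    Annihilates (E := E) H (formMomentum α) := by
  let S : Submodule ℝ E := subgroupLieAlgebra E H
  have hle : S ≤ LinearMap.ker (formMomentum (E := E) α).toLinearMap := by
    refine Submodule.span_le.2 ?_
    rintro _ ⟨c, hc, hadd, rfl, hcH⟩
    have c0 := oneParameter_zero hadd
    have hx : ContDiff ℝ ∞ fun x : Euc 1 => x 0 := by fun_prop
    have hr : SmoothMap 𝓘(ℝ, E) fun x : Euc 1 => c (x 0) := hc.comp hx.contMDiff
    -- the curve `c` becomes constant in `G/H`, and forms vanish on constant plots
    have h1 := toFun_coset (E := E) hH α (fun x : Euc 1 => c (x 0))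
      ((IsManifoldDiffeology.isPlot_iff (E := E)).2 hr) 0 (EuclideanSpace.single 0 1)
    rw [rlog_comp_coord hc] at h1
    refine show formMomentum (E := E) α (velocity c) = 0 from Eq.trans ?_ (h1.symm.trans ?_)
    · rw [velocity_eq_rlog c0]
    · rw [← α.toFun_const ((1 : G) : G ⧸ H) (0 : Euc 1) (EuclideanSpace.single 0 1)]
      refine congrArg (fun b : Euc 1 [⋀^Fin 1]→L[ℝ] ℝ => b ![EuclideanSpace.single 0 1])
        (congrFun (α.toFun_congr (funext fun w => ?_) _ _) 0)
      exact QuotientGroup.eq.2 (by simpa using hcH _)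
  exact fun Z hZ => hle hZ

/-- Every `1`-form on `G/H` comes from a right-invariant form on `G`. -/
theorem cosetForm_formMomentum {H : Subgroup G} (hH : Dense (H : Set G)) (α : DForm (G ⧸ H) 1) :
    cosetForm (E := E) hH (formMomentum α) (annihilates_formMomentum hH α) = α := by
  ext1
  funext n p hp u
  obtain ⟨q, hq, hqp⟩ := hp u
  refine oneForm_ext fun v => ?_
  rw [cosetForm_apply hH _ _ hp q hq u hqp, ← toFun_coset hH α q hq]
  exact congrArg (fun b : Euc n [⋀^Fin 1]→L[ℝ] ℝ => b ![v])
    (α.toFun_germ (dSmooth_coset H n q hq) hp hqp)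

end FormsOnGroup

/-! ### Exact Hamiltonian spaces, and transfer along isomorphisms -/

section Exact
variable {E : Type*} [NormedAddCommGroup E] [NormedSpace ℝ E]
  {G : Type*} [TopologicalSpace G] [ChartedSpace E G] [Group G] [LieGroup 𝓘(ℝ, E) ∞ G]
  [DiffeologicalSpace G] [IsManifoldDiffeology E G]
  {X : Type*} [DiffeologicalSpace X] [MulAction G X]

theorem isPlot_orbit_curve (hs : DSmooth fun a : G × X => a.1 • a.2) {c : ℝ → G}
    (hc : SmoothMap 𝓘(ℝ, E) c) (x : X) : IsPlot (fun s : Euc 1 => c (s 0) • x) := by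
  have h0 : ContDiff ℝ ∞ (fun s : Euc 1 => s 0) := by fun_prop
  exact hs 1 (fun s => (c (s 0), x))
    ⟨(IsManifoldDiffeology.isPlot_iff (E := E)).2 (hc.comp h0.contMDiff), isPlot_const⟩

/-- The value of a `1`-form at `y` in the direction `v` may be computed on the restriction of the
plot to the line in this direction that passes through `y` at the time `r`. -/
theorem DForm.toFun_along_line (α : DForm X 1) {n : ℕ} {p : Euc n → X} (hp : IsPlot p)
    {q : Euc 1 → X} (hq : IsPlot q) (y v : Euc n) (r : ℝ)
    (h : ∀ s : Euc 1, q s = p (y + (s 0 - r) • v)) :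
    α.toFun p hp y ![v] =
      α.toFun q hq (EuclideanSpace.single 0 r) ![EuclideanSpace.single 0 1] := by
  have hf : ContDiff ℝ ∞ fun s : Euc 1 => y + (s 0 - r) • v := by fun_prop
  have hc := α.compat p hp _ hf (EuclideanSpace.single 0 r)
  rw [α.toFun_congr (show q = p ∘ _ from funext h) hq (isPlot_reparam hp hf), hc]
  let l : Euc 1 →L[ℝ] ℝ := EuclideanSpace.proj (0 : Fin 1)
  have hl : HasFDerivAt (fun s : Euc 1 => s 0) l (EuclideanSpace.single 0 r) := l.hasFDerivAt
  have hd := ((hl.sub_const r).smul_const v).const_add y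
  rw [hd.fderiv]
  simp only [ContinuousAlternatingMap.compContinuousLinearMap_apply]
  congr 1
  · simp
  · ext i
    simp [l]

/-- A smooth action preserving a `1`-form `α` is Hamiltonian for `dα`, with the moment map
`⟨Φ(x), Z⟩ = α(Z_X(x))`. On a plot `(s, t) ↦ c(s)(γ(t))`, the `t`-component of `α` does not
depend on `s` by invariance, so that the value of `dα` is minus the `t`-derivative of the
`s`-component, which is `⟨Φ(γ(t)), c'(0)⟩` at `s = 0`. -/
theorem isParasymplecticHamiltonian_of_exact (α : DForm X 1)
    (Φ : X → (GroupLieAlgebra 𝓘(ℝ, E) G →L[ℝ] ℝ)) (hs : DSmooth fun a : G × X => a.1 • a.2)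
    (hinv : ∀ (g : G) (n : ℕ) (p : Euc n → X) (hp : IsPlot p) (hgp : IsPlot fun u => g • p u),
      α.toFun (fun u => g • p u) hgp = α.toFun p hp)
    (hΦ : ∀ Z : GroupLieAlgebra 𝓘(ℝ, E) G, DSmooth fun x => Φ x Z)
    (heq : ∀ (g : G) (x : X), Φ (g • x) = coadjoint g (Φ x))
    (hα : ∀ (c : ℝ → G) (hc : SmoothMap 𝓘(ℝ, E) c), c 0 = 1 → ∀ x,
      α.toFun (fun s : Euc 1 => c (s 0) • x) (isPlot_orbit_curve hs hc x)
        0 ![EuclideanSpace.single 0 1] = Φ x (velocity c)) :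
    IsParasymplecticHamiltonian α.d Φ where
  smooth_action := hs
  closed n p hp u := extDeriv_extDeriv_apply (α.smooth p hp).contDiffAt (by
    simp only [minSmoothness_of_isRCLikeNormedField]
    exact WithTop.coe_le_coe.2 (le_top (a := (2 : ℕ∞))))
  invariant g := by
    ext1
    funext n p hp
    exact congrArg extDeriv (hinv g n p hp _)
  smooth_moment := hΦ
  equivariant := heq
  moment c hc c0 γ hγ t := by
    have hF := isPlot_sweep E hs hc hγ
    set θ := α.toFun _ hF with hθ
    have hd : Differentiable ℝ θ := (α.smooth _ hF).differentiable (by simp)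
    have hdv : ∀ v, Differentiable ℝ fun y => θ y v := fun v y =>
      ((ContinuousAlternatingMap.apply ℝ (Euc 2) ℝ v).differentiableAt).comp y (hd y)
    -- the component along `γ` is constant in the group direction, by invariance
    have h1 : ∀ s : ℝ, θ (!₂[0, t] + s • !₂[1, 0]) ![!₂[0, 1]] = θ !₂[0, t] ![!₂[0, 1]] := by
      have hγp : IsPlot fun s : Euc 1 => γ (s 0) :=
        hγ 1 _ (by fun_prop : ContDiff ℝ ∞ fun s : Euc 1 => s 0).isPlot
      have h2 : ∀ s : ℝ, θ (!₂[0, t] + s • !₂[1, 0]) ![!₂[0, 1]] =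
          α.toFun (fun s : Euc 1 => γ (s 0)) hγp (EuclideanSpace.single 0 t)
            ![EuclideanSpace.single 0 1] := fun s => by
        have hg : IsPlot fun r : Euc 1 => c s • γ (r 0) :=
          hs 1 (fun r => (c s, γ (r 0))) ⟨isPlot_const, hγp⟩
        rw [hθ, α.toFun_along_line hF hg _ _ t (fun r => by simp), hinv (c s) 1 _ hγp hg]
      intro s
      rw [h2 s, ← h2 0, zero_smul, add_zero]
    -- the component along the group direction is the moment map
    have h3 : ∀ τ : ℝ, θ (!₂[0, t] + τ • !₂[0, 1]) ![!₂[1, 0]] = Φ (γ (t + τ)) (velocity c) := by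
      intro τ
      rw [← hα c hc c0, hθ,
        α.toFun_along_line hF (isPlot_orbit_curve hs hc (γ (t + τ))) _ _ 0 (fun r => by simp),
        show EuclideanSpace.single (0 : Fin 1) (0 : ℝ) = 0 by ext i; simp]
    have e1 : fderiv ℝ (fun y => θ y ![!₂[0, 1]]) !₂[0, t] !₂[1, 0] = 0 := by
      rw [← (hdv _ _).lineDeriv_eq_fderiv, lineDeriv]
      simp only [h1, deriv_const]
    have e2 : fderiv ℝ (fun y => θ y ![!₂[1, 0]]) !₂[0, t] !₂[0, 1] =
        deriv (fun τ => Φ (γ τ) (velocity c)) t := by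
      rw [← (hdv _ _).lineDeriv_eq_fderiv, lineDeriv]
      simp only [h3]
      rw [deriv_comp_const_add (f := fun τ => Φ (γ τ) (velocity c)), add_zero]
    change extDeriv θ !₂[0, t] ![!₂[1, 0], !₂[0, 1]] = _
    rw [extDeriv_apply (hd _), Fin.sum_univ_two]
    have r0 : (0 : Fin 2).removeNth ![(!₂[1, 0] : Euc 2), !₂[0, 1]] = ![!₂[0, 1]] := by
      ext i; fin_cases i; rfl
    have r1 : (1 : Fin 2).removeNth ![(!₂[1, 0] : Euc 2), !₂[0, 1]] = ![!₂[1, 0]] := by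
      ext i; fin_cases i; rfl
    rw [r0, r1]
    simp [e1, e2]

/-- The Hamiltonian structure is carried along isomorphisms. -/
theorem IsParasymplecticHamiltonian.of_iso {Y : Type*} [DiffeologicalSpace Y] [MulAction G Y]
    {σ : DForm X 2} {Φ : X → (GroupLieAlgebra 𝓘(ℝ, E) G →L[ℝ] ℝ)} {σ' : DForm Y 2}
    {Φ' : Y → (GroupLieAlgebra 𝓘(ℝ, E) G →L[ℝ] ℝ)} {f : X ≃ Y}
    (hf : IsHamiltonianIso σ Φ σ' Φ' f) (h : IsParasymplecticHamiltonian σ Φ) :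
    IsParasymplecticHamiltonian σ' Φ' := by
  have hmom : ∀ y, Φ' y = Φ (f.symm y) := fun y => by rw [← hf.moment, f.apply_symm_apply]
  have hsymm : ∀ (g : G) (y : Y), f.symm (g • y) = g • f.symm y := fun g y => by
    rw [Equiv.symm_apply_eq, hf.equivariant, f.apply_symm_apply]
  have hs : DSmooth fun a : G × Y => a.1 • a.2 := fun n p hp => by
    have h1 := hf.smooth n _ (h.smooth_action n (fun u => ((p u).1, f.symm (p u).2))
      ⟨hp.1, hf.smooth_symm n _ hp.2⟩)
    have h2 : (fun a : G × Y => a.1 • a.2) ∘ p = f ∘ (fun a : G × X => a.1 • a.2) ∘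
        fun u => ((p u).1, f.symm (p u).2) := by
      funext u
      simp only [Function.comp_apply, hf.equivariant, f.apply_symm_apply]
    rw [h2]
    exact h1
  have hσ : ∀ (n : ℕ) (p : Euc n → Y) (hp : IsPlot p) (q : Euc n → X) (hq : IsPlot q),
      (∀ u, f.symm (p u) = q u) → σ'.toFun p hp = σ.toFun q hq := fun n p hp q hq hpq => by
    rw [← hf.pullback_form]
    exact σ'.toFun_congr (funext fun u => by simp [← hpq]) _ _
  exact {
    smooth_action := hs
    closed := fun n p hp u => by
      refine Eq.trans ?_ (h.closed n _ (hf.smooth_symm n p hp) u)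
      exact congrFun (congrArg extDeriv (hσ n p hp _ _ fun _ => rfl)) u
    invariant := fun g => by
      ext1
      funext n p hp
      have h1 := congrArg (fun τ : DForm X 2 => τ.toFun (f.symm ∘ p) (hf.smooth_symm n p hp))
        (h.invariant g)
      rw [hσ n p hp _ (hf.smooth_symm n p hp) fun _ => rfl]
      exact (hσ n _ _ _ _ fun u => hsymm g (p u)).trans h1
    smooth_moment := fun Z => by
      simp only [hmom]
      exact (h.smooth_moment Z).comp hf.smooth_symm
    equivariant := fun g y => by rw [hmom, hmom, hsymm, h.equivariant]
    moment := fun c hc c0 γ hγ t => by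
      simp only [hmom]
      rw [← h.moment c hc c0 (fun τ => f.symm (γ τ)) (hf.smooth_symm.comp hγ) t]
      exact congrArg (fun b : Euc 2 [⋀^Fin 2]→L[ℝ] ℝ => b ![!₂[1, 0], !₂[0, 1]])
        (congrFun (hσ 2 _ _ _ _ fun u => hsymm _ _) _) }

end Exact

/-! ### The potential of the reduced two-form -/

section Reduced
variable {E : Type*} [NormedAddCommGroup E] [NormedSpace ℝ E] [FiniteDimensional ℝ E]
  {G : Type*} [TopologicalSpace G] [ChartedSpace E G] [Group G] [LieGroup 𝓘(ℝ, E) ∞ G]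
  {H : Subgroup G}

theorem annihilates_momentum (hH : Dense (H : Set G)) (p : ZeroLevel E H) :
    Annihilates H (momentum p.1) :=
  (momentRight_eq_zero_iff_annihilates hH p.1).1 p.2

theorem isPlot_zeroLevel_iff {n : ℕ} (P : Euc n → ZeroLevel E H) :
    IsPlot P ↔ SmoothMap 𝓘(ℝ, E) (fun u => (P u).1.1) ∧
      ContDiff ℝ ∞ fun u => momentum (P u).1 :=
  have : CompleteSpace E := FiniteDimensional.complete ℝ E
  isPlot_cotangent_iff fun u => (P u).1

/-- The point of the zero level over `q` with momentum `μ`. -/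
noncomputable def zeroLevelMk (hH : Dense (H : Set G)) (q : G) (μ : E →L[ℝ] ℝ)
    (hμ : Annihilates H μ) : ZeroLevel E H :=
  ⟨ofMomentum q μ, (momentRight_eq_zero_iff_annihilates hH _).2
    (by rwa [momentum_ofMomentum])⟩

theorem momentum_zeroLevelMk (hH : Dense (H : Set G)) (q : G) (μ : E →L[ℝ] ℝ)
    (hμ : Annihilates H μ) : momentum (zeroLevelMk hH q μ hμ).1 = μ :=
  momentum_ofMomentum q μ

/-- Points of the zero level have the same class in `(T^*G)//H` if and only if their base points
have the same class in `G/H` and their momenta agree. -/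
theorem reduced_eq_iff {p p' : ZeroLevel E H} :
    Quotient.mk (orbitSetoid E H) p = Quotient.mk (orbitSetoid E H) p' ↔
      p.1.1⁻¹ * p'.1.1 ∈ H ∧ momentum p.1 = momentum p'.1 := by
  rw [Quotient.eq]
  constructor
  · rintro ⟨h, hh, e⟩
    rw [e, momentum_rightTranslate]
    refine ⟨?_, rfl⟩
    change p.1.1⁻¹ * (p.1.1 * h⁻¹) ∈ H
    rw [inv_mul_cancel_left]
    exact H.inv_mem hh
  · rintro ⟨hh, hμ⟩
    refine ⟨(p.1.1⁻¹ * p'.1.1)⁻¹, H.inv_mem hh, ?_⟩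
    rw [inv_inv]
    refine cotangent_ext_momentum ?_ ?_
    · exact (mul_inv_cancel_left p.1.1 p'.1.1).symm
    · rw [momentum_rightTranslate, hμ]

variable [DiffeologicalSpace G] [IsManifoldDiffeology E G]

/-- The restriction of `ϖ` to the zero level. -/
noncomputable def zeroLevelForm (E : Type*) [NormedAddCommGroup E] [NormedSpace ℝ E]
    {G : Type*} [TopologicalSpace G] [ChartedSpace E G] [Group G] [LieGroup 𝓘(ℝ, E) ∞ G]
    (H : Subgroup G) : DForm (ZeroLevel E H) 1 :=
  (canonicalForm E G).pullback (fun p : ZeroLevel E H => p.1) (dSmooth_val _)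

theorem zeroLevelForm_apply {n : ℕ} (P : Euc n → ZeroLevel E H) (hP : IsPlot P) (u v : Euc n) :
    (zeroLevelForm E H).toFun P hP u ![v] =
      momentum (P u).1 (rlog (fun w => (P w).1.1) u v) :=
  congrArg (fun l : Euc n →L[ℝ] ℝ => l v) (pullCovector_eq (fun w => (P w).1) u)

/-- Plots of the zero level with the same projection have the same momentum, which vanishes on `𝔥`,
so that `rightForm_basic` applies to their base points. -/
theorem zeroLevelForm_descends (hH : Dense (H : Set G)) (n : ℕ) (P Q : Euc n → ZeroLevel E H)
    (hP : IsPlot P) (hQ : IsPlot Q)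
    (h : ∀ u, Quotient.mk (orbitSetoid E H) (P u) = Quotient.mk (orbitSetoid E H) (Q u)) :
    (zeroLevelForm E H).toFun P hP = (zeroLevelForm E H).toFun Q hQ := by
  funext u
  refine oneForm_ext fun v => ?_
  have hp := (IsManifoldDiffeology.isPlot_iff (E := E)).2 ((isPlot_zeroLevel_iff P).1 hP).1
  have hq := (IsManifoldDiffeology.isPlot_iff (E := E)).2 ((isPlot_zeroLevel_iff Q).1 hQ).1
  rw [zeroLevelForm_apply, zeroLevelForm_apply, ← (reduced_eq_iff.1 (h u)).2]
  exact congrArg (fun l : Euc n →L[ℝ] ℝ => l v)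
    (rightForm_basic hH (annihilates_momentum hH (P u)) hp hq
      (fun w => (reduced_eq_iff.1 (h w)).1) u)

/-- The `1`-form on `(T^*G)//H` whose pull-back to the zero level is the restriction of `ϖ`. -/
noncomputable def reducedPotential (hH : Dense (H : Set G)) : DForm (ReducedSpace E H) 1 :=
  (zeroLevelForm E H).descend (s := orbitSetoid E H) (zeroLevelForm_descends hH)

theorem pullback_reducedPotential (hH : Dense (H : Set G)) :
    (reducedPotential (E := E) hH).pullback (Quotient.mk (orbitSetoid E H)) (dSmooth_mk _) =
      zeroLevelForm E H :=
  DForm.pullback_descend _ (zeroLevelForm_descends hH)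

theorem reducedPotential_apply (hH : Dense (H : Set G)) {n : ℕ} {p : Euc n → ReducedSpace E H}
    (hp : IsPlot p) (P : Euc n → ZeroLevel E H) (hP : IsPlot P)
    (u : Euc n) (h : (fun w => Quotient.mk (orbitSetoid E H) (P w)) =ᶠ[𝓝 u] p) (v : Euc n) :
    (reducedPotential hH).toFun p hp u ![v] =
      momentum (P u).1 (rlog (fun w => (P w).1.1) u v) := by
  rw [← (reducedPotential hH).toFun_germ (dSmooth_mk (orbitSetoid E H) n P hP) hp h,
    ← zeroLevelForm_apply P hP, ← pullback_reducedPotential hH]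
  rfl

/-- The reduced `2`-form exists and is unique: it is the differential of the potential, as the
pull-back to the zero level is injective on forms. -/
theorem isReducedForm_iff (hH : Dense (H : Set G)) (σ : DForm (ReducedSpace E H) 2) :
    IsReducedForm H σ ↔ σ = (reducedPotential hH).d := by
  have h : IsReducedForm H (reducedPotential (E := E) hH).d :=
    congrArg DForm.d (pullback_reducedPotential (E := E) hH)
  exact ⟨fun h' => DForm.pullback_mk_injective (h'.trans h.symm), fun e => e ▸ h⟩

/-! ### The Hamiltonian action on `(T^*G)//H` -/

theorem momentum_smul_zeroLevel (g : G) (p : ZeroLevel E H) :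
    momentum (g • p).1 = (momentum p.1).comp (Ad g⁻¹) := momentum_smul g p.1

theorem isPlot_smul_zeroLevel {n : ℕ} {g : Euc n → G} (hg : IsPlot g)
    {P : Euc n → ZeroLevel E H} (hP : IsPlot P) : IsPlot fun u => g u • P u := by
  obtain ⟨h1, h2⟩ := (isPlot_zeroLevel_iff P).1 hP
  have hg' := smoothMap_of_isPlot (E := E) hg
  refine (isPlot_zeroLevel_iff _).2 ⟨hg'.mul h1, ?_⟩
  simp only [momentum_smul_zeroLevel]
  have h3 : ContMDiff 𝓘(ℝ, Euc n) 𝓘(ℝ, E →L[ℝ] E) ∞ fun u => Ad (E := E) (g u)⁻¹ :=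
    contMDiff_Ad.comp hg'.inv
  exact h2.clm_comp h3.contDiff

theorem dSmooth_smul_reduced : DSmooth fun a : G × ReducedSpace E H => a.1 • a.2 := by
  intro n p hp u
  obtain ⟨P, hP, hPp⟩ := hp.2 u
  refine ⟨fun w => (p w).1 • P w, isPlot_smul_zeroLevel (E := E) hp.1 hP, ?_⟩
  filter_upwards [hPp] with w hw
  change _ = (p w).1 • (p w).2
  rw [← hw]
  rfl

/-- The value of the reduced potential along the orbit of `x` under a plot `c` of `G`
through the identity. -/
theorem reducedPotential_orbit (hH : Dense (H : Set G)) {n : ℕ} {c : Euc n → G}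
    (hc : SmoothMap 𝓘(ℝ, E) c) (c0 : c 0 = 1) (x : ReducedSpace E H)
    (h : IsPlot fun w => c w • x) (v : Euc n) :
    (reducedPotential hH).toFun _ h 0 ![v] =
      (show E →L[ℝ] ℝ from reducedMoment H x) (rlog c 0 v) := by
  induction x using Quotient.inductionOn with
  | h p =>
  have hc' := (IsManifoldDiffeology.isPlot_iff (E := E)).2 hc
  refine (reducedPotential_apply hH h (fun w => c w • p)
    (isPlot_smul_zeroLevel (E := E) hc' isPlot_const) 0 Filter.EventuallyEq.rfl v).trans ?_
  rw [momentum_smul_zeroLevel, c0, inv_one, ContinuousLinearMap.comp_apply, Ad_one]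
  exact congrArg (fun l : Euc n →L[ℝ] E => momentum p.1 (l v)) (rlog_mul_right (hc.mdiffAt 0) _)

theorem isParasymplecticHamiltonian_reduced (hH : Dense (H : Set G)) :
    IsParasymplecticHamiltonian (reducedPotential (E := E) hH).d (reducedMoment H) := by
  refine isParasymplecticHamiltonian_of_exact _ _ dSmooth_smul_reduced ?_ ?_ ?_ ?_
  · intro g n p hp hgp
    funext u
    refine oneForm_ext fun v => ?_
    obtain ⟨P, hP, hPp⟩ := hp u
    have h1 := (isPlot_zeroLevel_iff P).1 hP
    rw [reducedPotential_apply hH hp P hP u hPp, reducedPotential_apply hH hgp (fun w => g • P w)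
      (isPlot_smul_zeroLevel (E := E) isPlot_const hP) u (hPp.mono fun w hw =>
        congrArg (fun x : ReducedSpace E H => g • x) hw),
      momentum_smul_zeroLevel, ContinuousLinearMap.comp_apply]
    refine congrArg _ (Eq.trans ?_ (Ad_inv_Ad g _))
    exact congrArg (Ad g⁻¹) (rlog_mul_left (h1.1.mdiffAt u) g v)
  · intro Z n p hp
    refine ContDiff.isPlot ?_
    rw [contDiff_iff_contDiffAt]
    intro u
    obtain ⟨P, hP, hPp⟩ := hp u
    have h1 := (isPlot_zeroLevel_iff P).1 hP
    refine ((h1.2.clm_apply contDiff_const).contDiffAt (x := u) |>.congr_of_eventuallyEq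
      (f := fun w => momentum (P w).1 Z) ?_)
    filter_upwards [hPp] with w hw
    change (reducedMoment H (p w)) Z = _
    rw [← hw]
    rfl
  · intro g x
    induction x using Quotient.inductionOn with
    | h p =>
      ext Z
      refine Eq.trans ?_ (coadjoint_apply g (momentLeft p.1) Z).symm
      exact congrArg (fun l : E →L[ℝ] ℝ => l Z) (momentum_smul_zeroLevel g p)
  · intro c hc c0 x
    have hx : ContDiff ℝ ∞ fun s : Euc 1 => s 0 := by fun_prop
    have hr : SmoothMap 𝓘(ℝ, E) fun s : Euc 1 => c (s 0) := hc.comp hx.contMDiff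
    refine (reducedPotential_orbit hH hr (by simpa using c0) x _ _).trans ?_
    rw [rlog_comp_coord hc, velocity_eq_rlog c0]
    rfl

end Reduced

/-! ### The isomorphism with the cotangent space of the coset space -/

section Iso
variable {E : Type*} [NormedAddCommGroup E] [NormedSpace ℝ E] [FiniteDimensional ℝ E]
  {G : Type*} [TopologicalSpace G] [ChartedSpace E G] [Group G] [LieGroup 𝓘(ℝ, E) ∞ G]
  [DiffeologicalSpace G] [IsManifoldDiffeology E G] {H : Subgroup G}

theorem cosetForm_congr (hH : Dense (H : Set G)) {ν ν' : E →L[ℝ] ℝ} (hν : Annihilates H ν)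
    (hν' : Annihilates H ν') (h : ν = ν') : cosetForm hH ν hν = cosetForm hH ν' hν' := by
  subst h; rfl

/-- The point and the `1`-form on `G/H` defined by a point of the zero level. -/
noncomputable def toCosetPair (hH : Dense (H : Set G)) (p : ZeroLevel E H) :
    (G ⧸ H) × DForm (G ⧸ H) 1 :=
  (p.1.1, cosetForm hH (momentum p.1) (annihilates_momentum hH p))

/-- The isomorphism `(T^*G)//H → T^*(G/H)` as a map: the class of the covector of momentum `μ` at
`q` goes to the value at `qH` of the `1`-form defined by `μ`. -/
noncomputable def toCotangent (hH : Dense (H : Set G)) :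
    ReducedSpace E H → DCotangent (G ⧸ H) :=
  Quotient.lift (fun p => Quotient.mk (cotSetoid (G ⧸ H)) (toCosetPair hH p)) fun p p' h => by
    obtain ⟨h1, h2⟩ := reduced_eq_iff.1 (Quotient.sound h)
    exact congrArg _ (Prod.ext (QuotientGroup.eq.2 h1) (cosetForm_congr hH
      (annihilates_momentum hH p) (annihilates_momentum hH p') h2))

/-- The values of two `1`-forms on `G/H` at one point determine their momenta, since a plot of `G`
can be chosen to pass through that point in all directions of the Lie algebra. -/
theorem toCotangent_injective (hH : Dense (H : Set G)) :
    Function.Injective (toCotangent (E := E) hH) := by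
  intro x y
  induction x using Quotient.inductionOn with
  | h p =>
  induction y using Quotient.inductionOn with
  | h p' =>
  intro h
  obtain ⟨h1, h2⟩ : cotSetoid (G ⧸ H) (toCosetPair hH p) (toCosetPair hH p') := Quotient.exact h
  refine reduced_eq_iff.2 ⟨QuotientGroup.eq.1 h1, ?_⟩
  obtain ⟨d, L, c, hc, c0, hL⟩ := exists_centered_plot (E := E) (G := G)
  have hq : IsPlot fun w => c w * p.1.1 :=
    (IsManifoldDiffeology.isPlot_iff (E := E)).2 (hc.mul contMDiff_const)
  have h3 := h2 d (fun w => ((c w * p.1.1 : G) : G ⧸ H)) (dSmooth_coset H d _ hq)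
    (by simp only [c0, one_mul]; rfl)
  have h4 : ∀ v, rlog (E := E) (fun w => c w * p.1.1) 0 v = L v := fun v => by
    rw [rlog_mul_right (hc.mdiffAt 0), hL]
  ext e
  have h5 := congrArg (fun b : Euc d [⋀^Fin 1]→L[ℝ] ℝ => b ![L.symm e]) h3
  simp only [toCosetPair] at h5
  rw [cosetForm_apply hH _ _ _ _ hq 0 Filter.EventuallyEq.rfl,
    cosetForm_apply hH _ _ _ _ hq 0 Filter.EventuallyEq.rfl, h4, L.apply_symm_apply] at h5
  exact h5

theorem toCosetPair_zeroLevelMk (hH : Dense (H : Set G)) (q : G) (α : DForm (G ⧸ H) 1) :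
    toCosetPair hH (zeroLevelMk (E := E) hH q (formMomentum α) (annihilates_formMomentum hH α)) =
      ((q : G ⧸ H), α) := by
  refine Prod.ext rfl ?_
  exact (cosetForm_congr hH (annihilates_momentum hH _) (annihilates_formMomentum hH α)
    (momentum_zeroLevelMk hH q _ _)).trans (cosetForm_formMomentum hH α)

theorem toCotangent_surjective (hH : Dense (H : Set G)) :
    Function.Surjective (toCotangent (E := E) hH) := by
  intro y
  obtain ⟨⟨x, α⟩, rfl⟩ := Quotient.exists_rep y
  obtain ⟨q, rfl⟩ := Quotient.exists_rep x
  exact ⟨Quotient.mk _ (zeroLevelMk hH q (formMomentum α) (annihilates_formMomentum hH α)),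
    congrArg (Quotient.mk _) (toCosetPair_zeroLevelMk hH q α)⟩

/-- The form `cosetForm ν` depends smoothly on `ν`. -/
theorem isPlot_cosetForm (hH : Dense (H : Set G)) {n : ℕ} {ν : Euc n → E →L[ℝ] ℝ}
    (hν : ContDiff ℝ ∞ ν) (hν' : ∀ u, Annihilates H (ν u)) :
    IsPlot fun u => cosetForm hH (ν u) (hν' u) := by
  intro m p hp
  rw [contDiff_iff_contDiffAt]
  intro w₀
  obtain ⟨q, hq, hqp⟩ := hp w₀.2
  have h1 : ContDiff ℝ ∞ fun w : Euc n × Euc m => (ν w.1).comp (rlog (E := E) q w.2) :=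
    (hν.comp contDiff_fst).clm_comp
      ((contDiff_rlog (smoothMap_of_isPlot hq)).comp contDiff_snd)
  have h2 : ContDiff ℝ ∞ fun w : Euc n × Euc m =>
      oneForm ((ν w.1).comp (rlog (E := E) q w.2)) :=
    (ContinuousAlternatingMap.ofSubsingletonLIE (𝕜 := ℝ) (E := Euc m) (F := ℝ)
      (0 : Fin 1)).toContinuousLinearEquiv.contDiff.comp h1
  refine h2.contDiffAt.congr_of_eventuallyEq ?_
  filter_upwards [continuous_snd.continuousAt.eventually hqp.eventually_nhds] with w hw
  exact oneForm_ext fun v => cosetForm_apply hH _ _ hp q hq w.2 hw v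

theorem isPlot_toCosetPair (hH : Dense (H : Set G)) {n : ℕ} {P : Euc n → ZeroLevel E H}
    (hP : IsPlot P) : IsPlot fun u => toCosetPair hH (P u) := by
  obtain ⟨h1, h2⟩ := (isPlot_zeroLevel_iff P).1 hP
  exact ⟨dSmooth_coset H n _ ((IsManifoldDiffeology.isPlot_iff (E := E)).2 h1),
    isPlot_cosetForm hH h2 fun u => annihilates_momentum hH (P u)⟩

theorem dSmooth_toCotangent (hH : Dense (H : Set G)) : DSmooth (toCotangent (E := E) hH) := by
  intro n p hp u
  obtain ⟨P, hP, hPp⟩ := hp u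
  refine ⟨fun w => toCosetPair hH (P w), isPlot_toCosetPair hH hP, ?_⟩
  filter_upwards [hPp] with w hw
  exact congrArg (toCotangent hH) hw

/-- The momentum of a `1`-form on `G/H` depends smoothly on the form: its components are the values
of the form on one fixed plot. -/
theorem contDiff_formMomentum (hH : Dense (H : Set G)) {n : ℕ} {α : Euc n → DForm (G ⧸ H) 1}
    (hα : IsPlot α) : ContDiff ℝ ∞ fun u => formMomentum (E := E) (α u) := by
  obtain ⟨d, L, c, hc, c0, hL⟩ := exists_centered_plot (E := E) (G := G)
  have hc' : IsPlot c := (IsManifoldDiffeology.isPlot_iff (E := E)).2 hc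
  rw [contDiff_clm_apply_iff]
  intro e
  have key : ∀ u, formMomentum (E := E) (α u) e =
      (α u).toFun (fun w => (c w : G ⧸ H)) (dSmooth_coset H d c hc') 0 ![L.symm e] := fun u => by
    rw [toFun_coset (E := E) hH (α u) c hc', hL, L.apply_symm_apply]
  simp only [key]
  exact (ContinuousAlternatingMap.apply ℝ (Euc d) ℝ ![L.symm e]).contDiff.comp
    ((hα d _ (dSmooth_coset H d c hc')).comp
      (contDiff_id.prodMk (contDiff_const (c := (0 : Euc d)))))

/-- The isomorphism `(T^*G)//H ≃ T^*(G/H)`. -/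
noncomputable def cotangentEquiv (hH : Dense (H : Set G)) :
    ReducedSpace E H ≃ DCotangent (G ⧸ H) :=
  Equiv.ofBijective (toCotangent hH) ⟨toCotangent_injective hH, toCotangent_surjective hH⟩

theorem dSmooth_cotangentEquiv_symm (hH : Dense (H : Set G)) :
    DSmooth (cotangentEquiv (E := E) hH).symm := by
  intro n p hp u
  obtain ⟨a, ha, hap⟩ := hp u
  obtain ⟨q, hq, hqa⟩ := ha.1 u
  refine ⟨fun w => zeroLevelMk hH (q w) (formMomentum (a w).2)
    (annihilates_formMomentum hH (a w).2), ?_, ?_⟩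
  · refine (isPlot_zeroLevel_iff _).2 ⟨smoothMap_of_isPlot hq, ?_⟩
    simp only [momentum_zeroLevelMk]
    exact contDiff_formMomentum hH ha.2
  · filter_upwards [hap, hqa] with w hw hw'
    refine ((Equiv.symm_apply_eq _).2 ?_).symm
    rw [← hw]
    refine (congrArg (Quotient.mk _) ((toCosetPair_zeroLevelMk hH (q w) (a w).2).trans ?_)).symm
    exact Prod.ext hw' rfl

variable [IsSmoothAction G (G ⧸ H)]

theorem toCotangent_smul (hH : Dense (H : Set G)) (g : G) (x : ReducedSpace E H) :
    toCotangent hH (g • x) = g • toCotangent hH x := by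
  induction x using Quotient.inductionOn with
  | h p =>
  refine Quotient.sound ⟨rfl, fun n r hr _ => oneForm_ext fun v => ?_⟩
  obtain ⟨q, hq, hqr⟩ := hr 0
  have hq' : IsPlot fun w => g⁻¹ * q w := (IsManifoldDiffeology.isPlot_iff (E := E)).2
    (contMDiff_const.mul (smoothMap_of_isPlot hq))
  refine (cosetForm_apply hH _ (annihilates_momentum hH (g • p)) hr q hq 0 hqr v).trans ?_
  refine Eq.trans ?_ (cosetForm_apply hH _ (annihilates_momentum hH p)
    (dSmooth_smul_left g⁻¹ n r hr) (fun w => g⁻¹ * q w) hq' 0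
    (hqr.mono fun w hw => congrArg (fun y : G ⧸ H => g⁻¹ • y) hw) v).symm
  rw [rlog_mul_left ((smoothMap_of_isPlot hq).mdiffAt 0), momentum_smul_zeroLevel]
  rfl

/-- The isomorphism carries the Liouville form to the potential of the reduced form: both pull back
to `⟨μ, (δq)q⁻¹⟩` on the zero level. -/
theorem pullback_liouville_toCotangent (hH : Dense (H : Set G)) :
    (liouville (G ⧸ H)).pullback (toCotangent (E := E) hH) (dSmooth_toCotangent hH) =
      reducedPotential hH := by
  refine DForm.pullback_mk_injective ((?_ : _ = _).trans (pullback_reducedPotential hH).symm)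
  ext1
  funext n P hP u
  have h1 : IsPlot fun w => toCosetPair hH (P w) := isPlot_toCosetPair hH hP
  have h2 := congrArg (fun θ : DForm ((G ⧸ H) × DForm (G ⧸ H) 1) 1 => θ.toFun _ h1 u)
    (pullback_liouville (G ⧸ H))
  refine Eq.trans h2 (oneForm_ext fun v => ?_)
  rw [zeroLevelForm_apply P hP]
  have h3 := (IsManifoldDiffeology.isPlot_iff (E := E)).2 ((isPlot_zeroLevel_iff P).1 hP).1
  exact cosetForm_apply hH _ (annihilates_momentum hH (P u)) _ _ h3 u Filter.EventuallyEq.rfl v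

/-- Both moment maps are `Z ↦ θ(Z_X)` for the invariant potentials `θ` of the two spaces, which
correspond to each other. -/
theorem cotangentMoment_toCotangent (hH : Dense (H : Set G)) (x : ReducedSpace E H) :
    cotangentMoment E (G := G) (toCotangent hH x) = reducedMoment H x := by
  obtain ⟨d, L, c, hc, c0, hL⟩ := exists_centered_plot (E := E) (G := G)
  have hc' : IsPlot c := (IsManifoldDiffeology.isPlot_iff (E := E)).2 hc
  let a : DForm G 1 :=
    (liouville (G ⧸ H)).pullback (fun g : G => g • toCotangent hH x) (dSmooth_orbit E _)
  have hcx : IsPlot fun w => c w • x :=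
    dSmooth_smul_reduced d (fun w => (c w, x)) ⟨hc', isPlot_const⟩
  have h1 : rightValue (E := E) a 1 = reducedMoment H x := by
    ext e
    have h2 := toFun_eq_rightValue (E := E) a c hc' 0 (L.symm e)
    rw [c0, hL, L.apply_symm_apply] at h2
    rw [← h2]
    have h3 := reducedPotential_orbit hH hc c0 x hcx (L.symm e)
    rw [hL, L.apply_symm_apply, ← pullback_liouville_toCotangent hH] at h3
    refine Eq.trans ?_ h3
    exact congrArg (fun b : Euc d [⋀^Fin 1]→L[ℝ] ℝ => b ![L.symm e])
      (congrFun ((liouville (G ⧸ H)).toFun_congr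
        (funext fun w => (toCotangent_smul hH (c w) x).symm) _ _) 0)
  refine Eq.trans ?_ h1
  rw [rightValue]
  simp only [mul_one, tderiv_id]
  rfl

theorem isHamiltonianIso_cotangentEquiv (hH : Dense (H : Set G)) :
    IsHamiltonianIso (reducedPotential (E := E) hH).d (reducedMoment H) (liouville (G ⧸ H)).d
      (cotangentMoment E (G := G) (X := G ⧸ H)) (cotangentEquiv hH) where
  smooth := dSmooth_toCotangent hH
  smooth_symm := dSmooth_cotangentEquiv_symm hH
  equivariant := toCotangent_smul hH
  pullback_form := congrArg DForm.d (pullback_liouville_toCotangent hH)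
  moment := cotangentMoment_toCotangent hH

end Iso

end DiffeoKMS

theorem mainTheorem7 {E : Type*} [NormedAddCommGroup E] [NormedSpace ℝ E] [FiniteDimensional ℝ E]
    {G : Type*} [TopologicalSpace G] [ChartedSpace E G] [Group G] [LieGroup 𝓘(ℝ, E) ∞ G]
    [DiffeologicalSpace G] [DiffeoKMS.IsManifoldDiffeology E G]
    (H : Subgroup G) (hH : Dense (H : Set G)) :
    haveI : DiffeoKMS.IsSmoothAction G (G ⧸ H) := DiffeoKMS.isSmoothAction_coset E H
    (∃! σ : DiffeoKMS.DForm (DiffeoKMS.ReducedSpace E H) 2, DiffeoKMS.IsReducedForm H σ) ∧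
    ∀ σ : DiffeoKMS.DForm (DiffeoKMS.ReducedSpace E H) 2, DiffeoKMS.IsReducedForm H σ →
      DiffeoKMS.IsParasymplecticHamiltonian σ (DiffeoKMS.reducedMoment H) ∧
      DiffeoKMS.IsParasymplecticHamiltonian (DiffeoKMS.liouville (G ⧸ H)).d
        (DiffeoKMS.cotangentMoment E (G := G) (X := G ⧸ H)) ∧
      ∃ f : DiffeoKMS.ReducedSpace E H ≃ DiffeoKMS.DCotangent (G ⧸ H),
        DiffeoKMS.IsHamiltonianIso σ (DiffeoKMS.reducedMoment H)
          (DiffeoKMS.liouville (G ⧸ H)).d (DiffeoKMS.cotangentMoment E (G := G) (X := G ⧸ H)) f := by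
  have : DiffeoKMS.IsSmoothAction G (G ⧸ H) := DiffeoKMS.isSmoothAction_coset E H
  have hiso := DiffeoKMS.isHamiltonianIso_cotangentEquiv (E := E) hH
  have hred := DiffeoKMS.isParasymplecticHamiltonian_reduced (E := E) hH
  refine ⟨⟨_, (DiffeoKMS.isReducedForm_iff hH _).2 rfl,
    fun σ hσ => (DiffeoKMS.isReducedForm_iff hH σ).1 hσ⟩, fun σ hσ => ?_⟩
  obtain rfl := (DiffeoKMS.isReducedForm_iff hH σ).1 hσ
  exact ⟨hred, hred.of_iso hiso, _, hiso⟩
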